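/- **Proposition.** Let $\lambda>0$, $\alpha>2$, and let $\Phi=\{x_i\}\subset\mathbb{R}^2$ be a homogeneous Poisson point process of density $\lambda$ (the base stations), with i.i.d. marks $g_{x_i}\ge 0$ (power fading gains) independent of $\Phi$. Base station heights are $h=0$, so the pathloss is $\ell(r)=(r^2+h^2)^{-\alpha/2}=r^{-\alpha}$. The user is at the origin. If it is served by $x\in\Phi$, the interference is $I_x=\sum_{y\in\Phi\setminus\{x\}}g_y\|y\|^{-\alpha}$ and $\mathrm{SIR}_x=g_x\|x\|^{-\alpha}/I_x$. Under closest association the server is the closest point of $\Phi$; under strongest association it is the point with the highest SIR. The coverage probability is $\Pr[\mathrm{SIR}_x>\theta]$ with $x$ the server. Put $$\eta(s,m,r)={}_2F_1\Big(m,-\tfrac2\alpha;1-\tfrac2\alpha;-\tfrac{s}{m r^\alpha}\Big),\qquad \zeta(m)=-\frac{\Gamma(m+\frac2\alpha)\,\Gamma(-\frac2\alpha)}{\alpha\,\Gamma(m)},$$ where ${}_2F_1$ is the Gauss hypergeometric function, i.e. the analytic continuation of the Gauss series to $\mathbb{C}\setminus[1,\infty)$. For a server at distance $r$, let $\mathcal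 L_I(s)=\mathbb{E}\big[\exp(-s\sum_{y\in\Phi,\ \|y\|>\nu}g_y\|y\|^{-\alpha})\big]$, with $\nu=r$ for closest association and $\nu=0$ for strongest association. (i) (LOS, Nakagami-$m$ fading.) Let $m>0$ and suppose the marks have the Gamma law with shape $m$ and scale $1/m$. Then the total received power $\sum_{y\in\Phi} g_y\|y\|^{-\alpha}$ is almost surely finite, and for all $s\ge0$, $r>0$ the Laplace transform $\mathcal L_I(s)$ equals $$\mathcal{L}^{(\mathrm C)}(s,m)=\exp\big(-\pi\lambda r^2(\eta(s,m,r)-1)\big)\ \text{(closest)},\qquad \mathcal{L}^{(\mathrm S)}(s,m)=\exp\big(-2\pi\lambda\,\zeta(m)(s/m)^{2/\alpha}\big)\ \text{(strongest)}.$$ Moreover, for closest association $\mathbb{E}[e^{-sI_x}\mid\|x\|]$ is almost surely equal to $\mathcal{L}^{(\mathrm C)}(s,m)$ at $r=\|x\|$; and $\mathcal{L}^{(\mathrm S)}(s,m)$ is the Laplace transform of $I_x$ for a generic point $x$ of $\Phi$ in the Palm sense: $\mathbb{E}\sum_{x\in\Phi\cap B}e^{-sI_x}=\lambda|B|\,\mathcal{L}^{(\mathrm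 S)}(s,m)$ for all Borel sets $B\subseteq\mathbb{R}^2$. (ii) (NLOS, Rayleigh fading.) If the marks are exponential with mean $1$, the statements of (i) hold with $m=1$. For every $\theta>0$ the unified coverage expression $\int_0^\infty \mathcal L_I(\theta r^\alpha)f(r)\,dr$, with $f(r)=2\pi\lambda re^{-\pi\lambda r^2}$ for closest association and $f(r)=2\pi\lambda r$ for strongest association, equals respectively $$\frac{1}{\eta(\theta,1,1)}\qquad\text{and}\qquad\frac{1}{2\zeta(1)\,\theta^{2/\alpha}}.$$ These are the coverage probabilities: the first for every $\theta>0$ for closest association, the second for every $\theta\ge1$ for strongest association. -/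

import Mathlib

open MeasureTheory ProbabilityTheory Set
open scoped ENNReal

namespace Downlink

noncomputable section

/-- The plane in which the base stations are located; the typical user sits at the origin. -/
abbrev Plane : Type := EuclideanSpace ℝ (Fin 2)

/-! ### Special functions -/

/-- `F` is a holomorphic function on `ℂ \ [1, ∞)` which is the sum of the Gauss series
`∑ (a)ₖ (b)ₖ / (c)ₖ zᵏ / k!` on the open unit disc. -/
def IsGaussContinuation (a b c : ℂ) (F : ℂ → ℂ) : Prop :=
  DifferentiableOn ℂ F {z : ℂ | 1 - z ∈ Complex.slitPlane} ∧
    ∀ z ∈ Metric.ball (0 : ℂ) 1, F z = ordinaryHypergeometric a b c z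

open Classical in
/-- The Gauss hypergeometric function `₂F₁(a, b; c; z)` on `ℂ \ [1, ∞)`: the analytic continuation
of the Gauss series (Mathlib's `ordinaryHypergeometric` is the sum of the series only, which
diverges for `|z| > 1`). -/
def gauss2F1 (a b c z : ℂ) : ℂ :=
  if h : ∃ F : ℂ → ℂ, IsGaussContinuation a b c F then h.choose z else 0

/-- `η(s, m, r) = ₂F₁(m, -2/α; 1 - 2/α; -s / (m r^α))`. -/
def eta (α s m r : ℝ) : ℝ :=
  (gauss2F1 (m : ℂ) ((-(2 / α) : ℝ) : ℂ) ((1 - 2 / α : ℝ) : ℂ)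
    ((-(s / (m * r ^ α)) : ℝ) : ℂ)).re

/-- `ζ(m) = - Γ(m + 2/α) Γ(-2/α) / (α Γ(m))`. -/
def zetaFun (α m : ℝ) : ℝ :=
  -(Real.Gamma (m + 2 / α) * Real.Gamma (-(2 / α))) / (α * Real.Gamma m)

/-! ### The marked Poisson point process of base stations -/

section PointPattern

variable {Ω : Type*}

/-- The number of points of `{X i}` in the set `A`. -/
def count (X : ℕ → Ω → Plane) (A : Set Plane) (ω : Ω) : ℝ≥0∞ :=
  ∑' i, A.indicator (fun _ => 1) (X i ω)

/-- `{(X i, g i)}` is an independently marked homogeneous Poisson point process on the plane with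
density `lam` and mark law `ν`: numbers of points in Borel sets of finite area are Poisson with
mean `lam` times the area, numbers of points in disjoint sets are independent, and the marks are
i.i.d. with law `ν` and independent of the locations. -/
structure IsMarkedPPP [MeasurableSpace Ω] (P : Measure Ω) (lam : ℝ) (ν : Measure ℝ)
    (X : ℕ → Ω → Plane) (g : ℕ → Ω → ℝ) : Prop where
  measurable_loc : ∀ i, Measurable (X i)
  measurable_mark : ∀ i, Measurable (g i)
  poisson_count : ∀ A : Set Plane, MeasurableSet A → volume A ≠ ∞ →
    P.map (count X A) =
      (poissonMeasure (Real.toNNReal (lam * (volume A).toReal))).map (fun n : ℕ => (n : ℝ≥0∞))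
  indep_count : ∀ (n : ℕ) (A : Fin n → Set Plane), (∀ k, MeasurableSet (A k)) →
    (∀ k, volume (A k) ≠ ∞) → (Pairwise fun k l => Disjoint (A k) (A l)) →
    iIndepFun (fun k => count X (A k)) P
  law_mark : ∀ i, P.map (g i) = ν
  indep_mark : iIndepFun g P
  indep_loc_mark : IndepFun (fun ω i => X i ω) (fun ω i => g i ω) P

/-- Power-law pathloss `(r² + h²)^(-α/2)` for base stations of height `h`. -/
def pathloss (α h r : ℝ) : ℝ := (r ^ 2 + h ^ 2) ^ (-(α / 2))

/-- Power received at the origin from base station `i`, for the pathloss function `l`. -/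
def rxPower (l : ℝ → ℝ) (X : ℕ → Ω → Plane) (g : ℕ → Ω → ℝ) (i : ℕ) (ω : Ω) : ℝ≥0∞ :=
  ENNReal.ofReal (g i ω * l ‖X i ω‖)

/-- Aggregate interference when the user is served by base station `i`. -/
def interference (l : ℝ → ℝ) (X : ℕ → Ω → Plane) (g : ℕ → Ω → ℝ) (i : ℕ) (ω : Ω) : ℝ≥0∞ :=
  ∑' j, if j = i then 0 else rxPower l X g j ω

/-- Aggregate power received from the base stations at distance larger than `ρ`. -/
def interferenceBeyond (l : ℝ → ℝ) (X : ℕ → Ω → Plane) (g : ℕ → Ω → ℝ) (ρ : ℝ) (ω : Ω) : ℝ≥0∞ :=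
  ∑' j, if ρ < ‖X j ω‖ then rxPower l X g j ω else 0

/-- Signal-to-interference ratio when the user is served by base station `i`. -/
def SIR (l : ℝ → ℝ) (X : ℕ → Ω → Plane) (g : ℕ → Ω → ℝ) (i : ℕ) (ω : Ω) : ℝ≥0∞ :=
  rxPower l X g i ω / interference l X g i ω

/-! ### Association policies and coverage -/

/-- The two base station association policies. -/
inductive Association
  | closest
  | strongest

/-- Interferers lie beyond distance `r` of the user for closest association (when the server is at
distance `r`), and anywhere for strongest association. -/
def Association.exclusion : Association → ℝ → ℝ
  | .closest, r => r
  | .strongest, _ => 0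

/-- The density `f` of the serving distance: `2πλ exp(-πλr²) r` (closest), resp. `2πλ r`
(strongest; the intensity of the distances of all candidate servers). -/
def Association.density (lam : ℝ) : Association → ℝ → ℝ
  | .closest, r => 2 * Real.pi * lam * Real.exp (-(Real.pi * lam * r ^ 2)) * r
  | .strongest, r => 2 * Real.pi * lam * r

/-- The index of the serving base station: one at minimal distance (closest), resp. one with
maximal SIR (strongest). Ties and non-attained optima have probability zero. -/
def Association.server (l : ℝ → ℝ) (X : ℕ → Ω → Plane) (g : ℕ → Ω → ℝ) : Association → Ω → ℕ
  | .closest, ω => sInf {i | ∀ j, ‖X i ω‖ ≤ ‖X j ω‖}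
  | .strongest, ω => sInf {i | ∀ j, SIR l X g j ω ≤ SIR l X g i ω}

variable [MeasurableSpace Ω]

/-- Laplace transform `E[exp(-s I)]` of a (almost surely finite) nonnegative random variable. -/
def laplace (P : Measure Ω) (I : Ω → ℝ≥0∞) (s : ℝ) : ℝ :=
  ∫ ω, Real.exp (-(s * (I ω).toReal)) ∂P

/-- Laplace transform of the interference given a server at distance `r`. -/
def Association.laplaceInterference (a : Association) (P : Measure Ω) (l : ℝ → ℝ)
    (X : ℕ → Ω → Plane) (g : ℕ → Ω → ℝ) (r s : ℝ) : ℝ :=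
  laplace P (interferenceBeyond l X g (a.exclusion r)) s

/-- Coverage probability: the probability that the SIR of the serving base station exceeds `θ`. -/
def Association.coverage (a : Association) (P : Measure Ω) (l : ℝ → ℝ)
    (X : ℕ → Ω → Plane) (g : ℕ → Ω → ℝ) (θ : ℝ) : ℝ :=
  P.real {ω | ENNReal.ofReal θ < SIR l X g (a.server l X g ω) ω}

/-- The unified coverage expression for Rayleigh fading: `∫₀^∞ L_I(θ / l(r)) f(r) dr`. -/
def Association.coverageIntegral (a : Association) (P : Measure Ω) (lam : ℝ) (l : ℝ → ℝ)
    (X : ℕ → Ω → Plane) (g : ℕ → Ω → ℝ) (θ : ℝ) : ℝ :=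
  ∫ r in Ioi (0 : ℝ), a.laplaceInterference P l X g r (θ / l r) * a.density lam r

/-- The distance of the closest base station. -/
def closestDist (l : ℝ → ℝ) (X : ℕ → Ω → Plane) (g : ℕ → Ω → ℝ) (ω : Ω) : ℝ :=
  ‖X (Association.closest.server l X g ω) ω‖

/-- The conditional Laplace transform at `s` of the interference for closest association, given
the distance `R` of the serving base station, is `L R`. -/
def ClosestCondLaplace (P : Measure Ω) (l : ℝ → ℝ) (X : ℕ → Ω → Plane) (g : ℕ → Ω → ℝ)
    (s : ℝ) (L : ℝ → ℝ) : Prop :=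
  P[fun ω => Real.exp (-(s * (interference l X g (Association.closest.server l X g ω) ω).toReal)) |
      MeasurableSpace.comap (closestDist l X g) inferInstance]
    =ᵐ[P] fun ω => L (closestDist l X g ω)

/-- The Laplace transform at `s` of the interference `∑_{j ≠ i}` seen when the server is a generic
base station `i` located at `x` (reduced Palm version, expressed by the Campbell measure)
equals `L` for almost every `x`. -/
def PalmLaplace (P : Measure Ω) (lam : ℝ) (l : ℝ → ℝ) (X : ℕ → Ω → Plane) (g : ℕ → Ω → ℝ)
    (s L : ℝ) : Prop :=
  ∀ B : Set Plane, MeasurableSet B →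
    ∫⁻ ω, ∑' i, B.indicator
        (fun _ => ENNReal.ofReal (Real.exp (-(s * (interference l X g i ω).toReal)))) (X i ω) ∂P
      = ENNReal.ofReal (L * lam) * volume B

end PointPattern

end

end Downlink

namespace Downlink

/-! ### The decreasing exponential on `[0, ∞]` -/

/-! Everything rests on one identity for the Poisson process (Slivnyak–Mecke for exponential
functionals): the mean of `∑ᵢ w(Xᵢ) exp(-∑_{j≠i} f(Xⱼ))` is `λ ∫ w · exp(-λ ∫ (1 - e^{-f}))`. The
Laplace functional comes from independent Poisson counts by monotone approximation
(`laplace_functional`). Differentiating it in a direction `k` produces a sum over points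
(`lintegral_tsum_mul_expNeg`), and `k = w e^f` removes the chosen point from the exponent. By
discretising distances, `f` may also depend on the norm of the chosen point
(`lintegral_tsum_mul_expNeg_others_norm`). Since `f` takes values in `[0, ∞]` with `e^{-∞} = 0`, "no
point in this disc" is the case `f = ∞` on the disc.

Marks are independent of the locations. Integrating them out replaces `∑ gⱼ cⱼ` in the exponent by
`∑ ψ(cⱼ)`, where `e^{-ψ}` is the Laplace transform of the mark law; for the Gamma law `ψ(c) = m
log(1 + c/m)`. For exponential marks `P(g > b) = e^{-b}`, so the event that station `i` covers the
user also has an exponential as its conditional probability, with scale `θ ‖Xᵢ‖^α`.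

Two plane integrals remain. Over the whole plane, a layer-cake argument and a Gamma moment give
`ζ(m)` (`lintegral_one_sub_expNeg_gammaLogLaplace`). Outside a disc, the substitution `ρ = r
t^{-1/α}` gives a regularised Euler integral (`lintegral_one_sub_expNeg_gammaLogLaplace_beyond`),
identified with the continued `₂F₁` by the identity theorem (`isGaussContinuation_gaussIntegral`,
`gauss2F1_eq`).

Finally, each association policy becomes a sum over all stations. The closest station is a.s. unique
because the mean number of closest stations is exactly one (`ae_tsum_closest`). For `θ ≥ 1`, at most
one station has SIR above `θ` (`SIR_le_one`), so coverage by the strongest is a sum of indicators.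
By scaling, both coverage probabilities reduce to Gaussian integrals `λ ∫ exp(-πλc‖x‖²) = 1/c`. -/

/-- `e^{-t}` for `t ∈ [0, ∞]`. -/
noncomputable def expNeg (t : ℝ≥0∞) : ℝ≥0∞ := EReal.exp (-(t : EReal))

lemma expNeg_zero : expNeg 0 = 1 := by simp [expNeg]

lemma expNeg_top : expNeg ∞ = 0 := by simp [expNeg]

lemma expNeg_ofReal {t : ℝ} (ht : 0 ≤ t) :
    expNeg (ENNReal.ofReal t) = ENNReal.ofReal (Real.exp (-t)) := by
  rw [expNeg, EReal.coe_ennreal_ofReal, max_eq_left ht, ← EReal.coe_neg, EReal.exp_coe]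

lemma expNeg_of_ne_top {t : ℝ≥0∞} (ht : t ≠ ∞) :
    expNeg t = ENNReal.ofReal (Real.exp (-t.toReal)) := by
  rw [← expNeg_ofReal ENNReal.toReal_nonneg, ENNReal.ofReal_toReal ht]

lemma expNeg_antitone : Antitone expNeg := fun _ _ h =>
  EReal.exp_monotone (EReal.neg_le_neg_iff.2 (by exact_mod_cast h))

lemma expNeg_le_one (t : ℝ≥0∞) : expNeg t ≤ 1 := by
  simpa [expNeg_zero] using expNeg_antitone (zero_le (a := t))

lemma expNeg_ne_top (t : ℝ≥0∞) : expNeg t ≠ ∞ :=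
  ((expNeg_le_one t).trans_lt ENNReal.one_lt_top).ne

lemma expNeg_eq_zero {t : ℝ≥0∞} : expNeg t = 0 ↔ t = ∞ := by
  rw [expNeg, EReal.exp_eq_zero_iff, EReal.neg_eq_bot_iff, EReal.coe_ennreal_eq_top_iff]

lemma continuous_expNeg : Continuous expNeg :=
  ENNReal.continuous_exp.comp (continuous_neg.comp continuous_coe_ennreal_ereal)

lemma measurable_expNeg : Measurable expNeg := continuous_expNeg.measurable

@[fun_prop]
lemma _root_.Measurable.expNeg {β : Type*} [MeasurableSpace β] {f : β → ℝ≥0∞}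
    (hf : Measurable f) : Measurable fun x => expNeg (f x) := measurable_expNeg.comp hf

lemma expNeg_add (a b : ℝ≥0∞) : expNeg (a + b) = expNeg a * expNeg b := by
  rcases eq_or_ne a ∞ with rfl | ha
  · simp [expNeg_top]
  rcases eq_or_ne b ∞ with rfl | hb
  · simp [expNeg_top]
  rw [expNeg_of_ne_top ha, expNeg_of_ne_top hb, expNeg_of_ne_top (ENNReal.add_ne_top.2 ⟨ha, hb⟩),
    ENNReal.toReal_add ha hb, neg_add, Real.exp_add, ENNReal.ofReal_mul (Real.exp_nonneg _)]

lemma expNeg_sum {ι : Type*} (s : Finset ι) (f : ι → ℝ≥0∞) :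
    expNeg (∑ i ∈ s, f i) = ∏ i ∈ s, expNeg (f i) := by
  classical
  induction s using Finset.induction_on with
  | empty => simp [expNeg_zero]
  | insert a s ha ih => rw [Finset.sum_insert ha, Finset.prod_insert ha, expNeg_add, ih]

lemma expNeg_mul_nat (a : ℝ≥0∞) (n : ℕ) : expNeg (a * n) = expNeg a ^ n := by
  induction n with
  | zero => simp [expNeg_zero]
  | succ n ih => rw [Nat.cast_succ, mul_add, mul_one, expNeg_add, ih, pow_succ]

lemma expNeg_iSup (f : ℕ → ℝ≥0∞) : expNeg (⨆ n, f n) = ⨅ n, expNeg (f n) :=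
  Antitone.map_ciSup_of_continuousAt continuous_expNeg.continuousAt expNeg_antitone
    (OrderTop.bddAbove _)

lemma one_sub_expNeg_monotone : Monotone fun t => 1 - expNeg t := fun _ _ h =>
  tsub_le_tsub_left (expNeg_antitone h) _

lemma one_sub_expNeg_iSup (f : ℕ → ℝ≥0∞) : 1 - expNeg (⨆ n, f n) = ⨆ n, (1 - expNeg (f n)) := by
  rw [expNeg_iSup, ENNReal.sub_iInf]

lemma one_sub_expNeg_le (t : ℝ≥0∞) : 1 - expNeg t ≤ t := by
  rcases eq_or_ne t ∞ with rfl | ht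
  · exact le_top
  rw [expNeg_of_ne_top ht, tsub_le_iff_right]
  conv_rhs => rw [← ENNReal.ofReal_toReal ht]
  rw [ENNReal.toReal_ofReal ENNReal.toReal_nonneg, ← ENNReal.ofReal_add ENNReal.toReal_nonneg (Real.exp_nonneg _), ENNReal.one_le_ofReal]
  linarith [Real.add_one_le_exp (-t.toReal)]

/-- The telescoping `1 - pq = (1 - p) + p(1 - q)`. It gives both the monotonicity of the dyadic
difference quotients and the splitting of the exponent of a perturbed functional. -/
lemma one_sub_expNeg_add (a b : ℝ≥0∞) :
    1 - expNeg (a + b) = (1 - expNeg a) + expNeg a * (1 - expNeg b) := by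
  rw [expNeg_add, ENNReal.mul_sub (fun _ _ => expNeg_ne_top a), mul_one,
    tsub_add_tsub_cancel (expNeg_le_one a) (mul_le_of_le_one_right' (expNeg_le_one b))]

/-- The difference quotients `2ⁿ (1 - e^{-K/2ⁿ})` of `1 - e^{-t}` at `0`. -/
noncomputable def expQuot (n : ℕ) (K : ℝ≥0∞) : ℝ≥0∞ := 2 ^ n * (1 - expNeg (K / 2 ^ n))

lemma measurable_expQuot (n : ℕ) : Measurable (expQuot n) := by
  unfold expQuot
  fun_prop

@[fun_prop]
lemma _root_.Measurable.expQuot {β : Type*} [MeasurableSpace β] {f : β → ℝ≥0∞} (n : ℕ)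
    (hf : Measurable f) : Measurable fun x => expQuot n (f x) := (measurable_expQuot n).comp hf

lemma expQuot_mono_right (n : ℕ) : Monotone (expQuot n) := fun _ _ h =>
  mul_le_mul_right (one_sub_expNeg_monotone (ENNReal.div_le_div_right h _)) _

lemma expQuot_mono_left (K : ℝ≥0∞) : Monotone fun n => expQuot n K := by
  refine monotone_nat_of_le_succ fun n => ?_
  -- With `t = K / 2^(n+1)`, the claim becomes `1 - e^{-2t} ≤ 2(1 - e^{-t})`.
  have h2 : K / 2 ^ n = K / 2 ^ (n + 1) + K / 2 ^ (n + 1) := by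
    rw [ENNReal.div_add_div_same, ← two_mul, pow_succ', ENNReal.mul_div_mul_left _ _ two_ne_zero
      ENNReal.ofNat_ne_top]
  rw [expQuot, expQuot, h2, one_sub_expNeg_add, pow_succ, mul_assoc, two_mul]
  gcongr
  exact mul_le_of_le_one_left' (expNeg_le_one _)

lemma expQuot_le (n : ℕ) (K : ℝ≥0∞) : expQuot n K ≤ K := by
  refine (mul_le_mul_right (one_sub_expNeg_le _) _).trans ?_
  rw [ENNReal.mul_div_cancel (by positivity) (by finiteness)]

lemma iSup_expQuot (K : ℝ≥0∞) : ⨆ n, expQuot n K = K := by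
  rcases eq_or_ne K ∞ with rfl | hK
  · have : ∀ n : ℕ, expQuot n ∞ = 2 ^ n := fun n => by
      rw [expQuot, ENNReal.top_div_of_ne_top (by finiteness), expNeg_top, tsub_zero, mul_one]
    simp_rw [this]
    exact iSup_eq_of_tendsto (pow_right_mono₀ one_le_two)
      (ENNReal.tendsto_pow_atTop_nhds_top_iff.2 (by norm_num))
  refine iSup_eq_of_tendsto (expQuot_mono_left K) ?_
  set k := K.toReal
  have h : ∀ n, expQuot n K = ENNReal.ofReal (2 ^ n * (1 - Real.exp (-(k / 2 ^ n)))) := fun n => by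
    have h2 : K / 2 ^ n = ENNReal.ofReal (k / 2 ^ n) := by
      rw [ENNReal.ofReal_div_of_pos (by positivity), ENNReal.ofReal_toReal hK,
        ENNReal.ofReal_pow zero_le_two, ENNReal.ofReal_ofNat]
    rw [expQuot, h2, expNeg_ofReal (by positivity), ENNReal.ofReal_mul (by positivity),
      ENNReal.ofReal_pow zero_le_two, ENNReal.ofReal_ofNat,
      ENNReal.ofReal_sub _ (Real.exp_nonneg _), ENNReal.ofReal_one]
  simp_rw [h]
  rw [← ENNReal.ofReal_toReal hK]
  refine ENNReal.tendsto_ofReal ?_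
  -- The quotients are the slopes of `t ↦ 1 - e^{-kt}` at `0`, sampled along `t = 2⁻ⁿ`.
  have hd : HasDerivAt (fun t : ℝ => 1 - Real.exp (-(k * t))) k 0 := by
    have := ((((hasDerivAt_id (0 : ℝ)).const_mul k).neg).exp).const_sub 1
    simpa using this
  have ht : Filter.Tendsto (fun n : ℕ => ((1 : ℝ) / 2) ^ n) Filter.atTop (nhdsWithin 0 {0}ᶜ) :=
    tendsto_nhdsWithin_iff.2 ⟨tendsto_pow_atTop_nhds_zero_of_lt_one (by norm_num) (by norm_num),
      Filter.Eventually.of_forall fun n => by simp⟩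
  refine ((hasDerivAt_iff_tendsto_slope_zero.1 hd).comp ht).congr fun n => ?_
  simp [div_eq_mul_inv]

/-! ### The Laplace functional of the Poisson process -/

lemma lintegral_pow_poissonMeasure (r : NNReal) {q : ℝ≥0∞} (hq : q ≤ 1) :
    ∫⁻ n, q ^ n ∂(poissonMeasure r) = expNeg (r * (1 - q)) := by
  have hq' : q ≠ ∞ := (hq.trans_lt ENNReal.one_lt_top).ne
  set p := q.toReal
  have hp : p ≤ 1 := ENNReal.toReal_le_of_le_ofReal zero_le_one (by simpa using hq)
  have hp0 : 0 ≤ p := ENNReal.toReal_nonneg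
  have hqp : q = ENNReal.ofReal p := (ENNReal.ofReal_toReal hq').symm
  have hs : HasSum (fun n : ℕ => Real.exp (-r) * r ^ n / n.factorial * p ^ n)
      (Real.exp (-(r * (1 - p)))) := by
    convert! (NormedSpace.expSeries_div_hasSum_exp (r * p : ℝ)).mul_left (Real.exp (-r)) using 1
    · ext n; rw [mul_pow]; ring
    · rw [← Real.exp_eq_exp_ℝ, ← Real.exp_add]; ring_nf
  rw [poissonMeasure, lintegral_sum_measure]
  simp_rw [lintegral_smul_measure, lintegral_dirac, smul_eq_mul]
  have : (r : ℝ≥0∞) * (1 - q) = ENNReal.ofReal (r * (1 - p)) := by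
    rw [ENNReal.ofReal_mul r.coe_nonneg, ENNReal.ofReal_sub _ hp0, ENNReal.ofReal_coe_nnreal,
      ENNReal.ofReal_one, hqp]
  rw [this, expNeg_ofReal (mul_nonneg r.coe_nonneg (sub_nonneg.2 hp)), ← hs.tsum_eq,
    ENNReal.ofReal_tsum_of_nonneg (fun n => by positivity) hs.summable]
  refine tsum_congr fun n => ?_
  rw [ENNReal.ofReal_mul (by positivity), ENNReal.ofReal_pow hp0, hqp]

section PPP

variable {Ω : Type*} [MeasurableSpace Ω] {P : Measure Ω} {lam : ℝ} {ν : Measure ℝ}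
    {X : ℕ → Ω → Plane} {g : ℕ → Ω → ℝ}

lemma measurable_count (hX : ∀ i, Measurable (X i)) {A : Set Plane} (hA : MeasurableSet A) :
    Measurable (count X A) :=
  Measurable.tsum fun i => (measurable_const.indicator hA).comp (hX i)

lemma IsMarkedPPP.lintegral_expNeg_mul_count (h : IsMarkedPPP P lam ν X g) {A : Set Plane}
    (hA : MeasurableSet A) (hAf : volume A ≠ ∞) (a : ℝ≥0∞) :
    ∫⁻ ω, expNeg (a * count X A ω) ∂P =
      expNeg (ENNReal.ofReal lam * (volume A * (1 - expNeg a))) := by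
  have hm : Measurable fun t : ℝ≥0∞ => expNeg (a * t) :=
    measurable_expNeg.comp (measurable_id.const_mul a)
  rw [← lintegral_map (f := fun t => expNeg (a * t)) hm (measurable_count h.measurable_loc hA),
    h.poisson_count A hA hAf, lintegral_map hm (by fun_prop)]
  simp_rw [expNeg_mul_nat]
  rw [lintegral_pow_poissonMeasure _ (expNeg_le_one a), ← mul_assoc]
  congr 2
  change ENNReal.ofReal (lam * (volume A).toReal) = _
  rw [ENNReal.ofReal_mul' ENNReal.toReal_nonneg, ENNReal.ofReal_toReal hAf]

/-- The level sets of `f` inside `B` are disjoint and of finite area, so their counts are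
independent Poisson variables, and the generating functions multiply. -/
lemma IsMarkedPPP.laplace_functional_simple (h : IsMarkedPPP P lam ν X g)
    (f : SimpleFunc Plane ℝ≥0∞) {B : Set Plane} (hB : MeasurableSet B) (hBf : volume B ≠ ∞) :
    ∫⁻ ω, expNeg (∑' i, B.indicator f (X i ω)) ∂P =
      expNeg (ENNReal.ofReal lam * ∫⁻ y in B, (1 - expNeg (f y))) := by
  set n := f.range.card
  let e : Fin n ≃ f.range := f.range.equivFin.symm
  let A : Fin n → Set Plane := fun k => f ⁻¹' {(e k : ℝ≥0∞)} ∩ B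
  have hA : ∀ k, MeasurableSet (A k) := fun k => (f.measurableSet_preimage _).inter hB
  have hAf : ∀ k, volume (A k) ≠ ∞ := fun k =>
    ((measure_mono inter_subset_right).trans_lt hBf.lt_top).ne
  have hd : Pairwise fun k l => Disjoint (A k) (A l) := fun k l hkl => by
    refine Set.disjoint_left.2 fun x hx hy => hkl ?_
    exact e.injective (Subtype.ext (hx.1.symm.trans hy.1))
  -- The sum over points is regrouped by the value of `f`.
  have hsum : ∀ ω, ∑' i, B.indicator f (X i ω) = ∑ k, (e k : ℝ≥0∞) * count X (A k) ω := fun ω => by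
    simp_rw [count, ← ENNReal.tsum_mul_left]
    rw [← tsum_fintype (L := SummationFilter.unconditional _), ENNReal.tsum_comm]
    refine tsum_congr fun i => ?_
    rw [tsum_fintype]
    by_cases hi : X i ω ∈ B
    · let k₀ := e.symm ⟨f (X i ω), f.mem_range_self _⟩
      have hk₀ : (e k₀ : ℝ≥0∞) = f (X i ω) := by simp [k₀]
      rw [Finset.sum_eq_single k₀, indicator_of_mem hi, hk₀,
        indicator_of_mem (show X i ω ∈ A k₀ from ⟨hk₀.symm, hi⟩), mul_one]
      · intro k _ hk
        rw [indicator_of_notMem, mul_zero]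
        rintro ⟨hk', -⟩
        exact hk (e.injective (Subtype.ext (hk'.symm.trans hk₀.symm)))
      · simp
    · rw [indicator_of_notMem hi, Finset.sum_eq_zero]
      intro k _
      rw [indicator_of_notMem (fun hk => hi hk.2), mul_zero]
  have hind := (h.indep_count n A hA hAf hd).comp (fun k t => expNeg ((e k : ℝ≥0∞) * t))
    fun k => measurable_expNeg.comp (measurable_id.const_mul _)
  simp_rw [hsum, expNeg_sum]
  have := lintegral_prod_eq_prod_lintegral_of_indepFun Finset.univ _ hind fun k =>
    (measurable_expNeg.comp (measurable_id.const_mul _)).comp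
      (measurable_count h.measurable_loc (hA k))
  simp only [Function.comp_apply] at this
  rw [this]
  simp_rw [h.lintegral_expNeg_mul_count (hA _) (hAf _)]
  rw [← expNeg_sum, ← Finset.mul_sum]
  congr 2
  have hmap : ∫⁻ y in B, (1 - expNeg (f y)) = (f.map fun t => 1 - expNeg t).lintegral
      (volume.restrict B) := by
    rw [← SimpleFunc.lintegral_eq_lintegral]; rfl
  rw [hmap, SimpleFunc.map_lintegral, ← Finset.sum_coe_sort f.range, ← Equiv.sum_comp e]
  refine Finset.sum_congr rfl fun k _ => ?_
  rw [Measure.restrict_apply (f.measurableSet_preimage _), mul_comm]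

/-- The Laplace functional of a Poisson process. -/
theorem IsMarkedPPP.laplace_functional [IsProbabilityMeasure P] (h : IsMarkedPPP P lam ν X g)
    {f : Plane → ℝ≥0∞} (hf : Measurable f) :
    ∫⁻ ω, expNeg (∑' i, f (X i ω)) ∂P =
      expNeg (ENNReal.ofReal lam * ∫⁻ y, (1 - expNeg (f y))) := by
  let B : ℕ → Set Plane := fun n => Metric.closedBall 0 n
  let F : ℕ → Plane → ℝ≥0∞ := fun n => (B n).indicator (SimpleFunc.eapprox f n)
  have hB : ∀ n, MeasurableSet (B n) := fun n => Metric.isClosed_closedBall.measurableSet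
  have hF : ∀ n, Measurable (F n) := fun n => (SimpleFunc.measurable _).indicator (hB n)
  have hmono : Monotone F := by
    intro m n hmn y
    refine (indicator_le_indicator (SimpleFunc.monotone_eapprox f hmn y)).trans
      (indicator_le_indicator_of_subset (Metric.closedBall_subset_closedBall ?_)
        (fun _ => zero_le) y)
    exact_mod_cast hmn
  have hsup : ∀ y, ⨆ n, F n y = f y := fun y => by
    refine le_antisymm (iSup_le fun n => ?_) ?_
    · refine (indicator_le_self _ _ _).trans ?_
      rw [← SimpleFunc.iSup_eapprox_apply hf y]
      exact le_iSup (fun n => SimpleFunc.eapprox f n y) n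
    · rw [← SimpleFunc.iSup_eapprox_apply hf y]
      refine iSup_le fun n => ?_
      obtain ⟨k, hk⟩ := exists_nat_ge ‖y‖
      refine le_iSup_of_le (max n k) ?_
      have hy : y ∈ B (max n k) := by
        simp only [B, mem_closedBall_zero_iff]
        exact hk.trans (by exact_mod_cast le_max_right n k)
      simp only [F, indicator_of_mem hy]
      exact SimpleFunc.monotone_eapprox f (le_max_left n k) y
  have htsum : ∀ ω, ∑' i, f (X i ω) = ⨆ n, ∑' i, F n (X i ω) := fun ω => by
    simp_rw [← lintegral_count, ← hsup]
    exact lintegral_iSup (fun n => measurable_from_top) fun m n hmn i => hmono hmn _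
  have hR : ∫⁻ y, (1 - expNeg (f y)) = ⨆ n, ∫⁻ y, (1 - expNeg (F n y)) := by
    -- Both sides pass to the limit: the right by monotone convergence from below, the left from
    -- above, which is allowed because `expNeg` is bounded by `1` on a probability space.
    simp_rw [← hsup, one_sub_expNeg_iSup]
    exact lintegral_iSup (fun n => measurable_const.sub (measurable_expNeg.comp (hF n)))
      fun m n hmn y => one_sub_expNeg_monotone (hmono hmn y)
  simp_rw [htsum, expNeg_iSup]
  rw [hR, ENNReal.mul_iSup, expNeg_iSup, lintegral_iInf]
  · refine iInf_congr fun n => ?_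
    rw [h.laplace_functional_simple _ (hB n) measure_closedBall_lt_top.ne,
      ← lintegral_indicator (hB n)]
    congr 3 with y
    by_cases hy : y ∈ B n
    · simp [F, hy]
    · simp [F, hy, expNeg_zero]
  · exact fun n => measurable_expNeg.comp
      (Measurable.tsum fun i => (hF n).comp (h.measurable_loc i))
  · exact fun m n hmn ω => expNeg_antitone (ENNReal.tsum_le_tsum fun i => hmono hmn _)
  · exact ((lintegral_mono fun ω => expNeg_le_one _).trans_lt (by simp)).ne

/-- Weighted Laplace functional. -/
theorem IsMarkedPPP.lintegral_tsum_mul_expNeg [IsProbabilityMeasure P]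
    (h : IsMarkedPPP P lam ν X g) {f k : Plane → ℝ≥0∞} (hf : Measurable f) (hk : Measurable k) :
    ∫⁻ ω, (∑' i, k (X i ω)) * expNeg (∑' i, f (X i ω)) ∂P =
      (ENNReal.ofReal lam * ∫⁻ y, k y * expNeg (f y)) *
        expNeg (ENNReal.ofReal lam * ∫⁻ y, (1 - expNeg (f y))) := by
  have hkn : ∀ n : ℕ, Measurable fun y => k y / 2 ^ n := fun n => hk.div_const _
  have hmS : ∀ {u : Plane → ℝ≥0∞}, Measurable u → Measurable fun ω => ∑' i, u (X i ω) :=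
    fun hu => Measurable.tsum fun i => hu.comp (h.measurable_loc i)
  set I := expNeg (ENNReal.ofReal lam * ∫⁻ y, (1 - expNeg (f y))) with hI
  have hIf : I ≠ ∞ := expNeg_ne_top _
  let E : ℕ → ℝ≥0∞ := fun n => ENNReal.ofReal lam * ∫⁻ y, expQuot n (k y) * expNeg (f y)
  have hstep : ∀ n, ∫⁻ ω, expQuot n (∑' i, k (X i ω)) * expNeg (∑' i, f (X i ω)) ∂P =
      I * expQuot n (E n) := fun n => by
    -- A difference quotient of `t ↦ exp(-∑ (f + t k))` at `t = 2⁻ⁿ`: a difference of two Laplace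
    -- functionals. Working with increasing quotients avoids any integrability assumption on `k`.
    have h1 : ∀ ω, expQuot n (∑' i, k (X i ω)) * expNeg (∑' i, f (X i ω)) =
        2 ^ n * (expNeg (∑' i, f (X i ω)) - expNeg (∑' i, (f (X i ω) + k (X i ω) / 2 ^ n))) :=
      fun ω => by
      rw [ENNReal.tsum_add, expNeg_add, expQuot, mul_assoc, mul_comm (_ - _),
        ENNReal.mul_sub (fun _ _ => expNeg_ne_top _), mul_one]
      simp_rw [div_eq_mul_inv, ENNReal.tsum_mul_right]
    have h2 : ∫⁻ y, (1 - expNeg (f y + k y / 2 ^ n)) =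
        (∫⁻ y, (1 - expNeg (f y))) + (∫⁻ y, expQuot n (k y) * expNeg (f y)) / 2 ^ n := by
      rw [div_eq_mul_inv, ← lintegral_mul_const _ (by fun_prop), ← lintegral_add_left (by fun_prop)]
      congr 1 with y
      have h2n : (2 : ℝ≥0∞) ^ n * (2 ^ n)⁻¹ = 1 :=
        ENNReal.mul_inv_cancel (by positivity) (by finiteness)
      rw [one_sub_expNeg_add, expQuot, mul_right_comm, mul_right_comm (2 ^ n), h2n, one_mul,
        mul_comm (1 - expNeg (k y / 2 ^ n))]
    simp_rw [h1]
    have hm1 := hmS hf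
    have hm2 : Measurable fun ω => ∑' i, (f (X i ω) + k (X i ω) / 2 ^ n) := hmS (hf.add (hkn n))
    rw [lintegral_const_mul _ (by fun_prop), lintegral_sub (by fun_prop), h.laplace_functional hf,
      h.laplace_functional (f := fun y => f y + k y / 2 ^ n) (hf.add (hkn n)), h2, mul_add, expNeg_add, ← hI, ← mul_div_assoc,
      expQuot, mul_left_comm I, ENNReal.mul_sub (fun _ _ => hIf), mul_one]
    · exact ((lintegral_mono fun ω => expNeg_le_one _).trans_lt (by simp)).ne
    · exact Filter.Eventually.of_forall fun ω => expNeg_antitone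
        (ENNReal.tsum_le_tsum fun i => le_self_add)
  have hEm : Monotone E := fun m n hmn => by
    dsimp only [E]
    gcongr with y
    exact expQuot_mono_left _ hmn
  have hE : ⨆ n, E n = ENNReal.ofReal lam * ∫⁻ y, k y * expNeg (f y) := by
    simp only [E]
    rw [← ENNReal.mul_iSup, ← lintegral_iSup]
    · simp_rw [← ENNReal.iSup_mul, iSup_expQuot]
    · exact fun n => ((measurable_expQuot n).comp hk).mul (measurable_expNeg.comp hf)
    · exact fun m n hmn y => mul_le_mul_left (expQuot_mono_left _ hmn) _
  -- Both the quotient index and `E` increase, so the double supremum is attained along the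
  -- diagonal.
  have hdiag : ⨆ n, expQuot n (E n) = ⨆ n, E n := by
    refine le_antisymm (iSup_mono fun n => expQuot_le n _) (iSup_le fun m => ?_)
    rw [← iSup_expQuot (E m)]
    refine iSup_le fun n => le_iSup_of_le (max n m) ?_
    exact (expQuot_mono_left _ (le_max_left n m)).trans
      (expQuot_mono_right _ (hEm (le_max_right n m)))
  have hL : ∫⁻ ω, (∑' i, k (X i ω)) * expNeg (∑' i, f (X i ω)) ∂P =
      ⨆ n, ∫⁻ ω, expQuot n (∑' i, k (X i ω)) * expNeg (∑' i, f (X i ω)) ∂P := by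
    rw [← lintegral_iSup]
    · simp_rw [← ENNReal.iSup_mul, iSup_expQuot]
    · exact fun n => ((measurable_expQuot n).comp (hmS hk)).mul (measurable_expNeg.comp (hmS hf))
    · exact fun m n hmn y => mul_le_mul_left (expQuot_mono_left _ hmn) _
  rw [hL]
  simp_rw [hstep]
  rw [← ENNReal.mul_iSup, hdiag, hE, mul_comm]

end PPP

section PPP

variable {Ω : Type*} [MeasurableSpace Ω] {P : Measure Ω} {lam : ℝ} {ν : Measure ℝ}
    {X : ℕ → Ω → Plane} {g : ℕ → Ω → ℝ}

/-! ### Reduced Campbell formulas -/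

/-- Campbell's formula. -/
lemma IsMarkedPPP.campbell_formula [IsProbabilityMeasure P] (h : IsMarkedPPP P lam ν X g)
    {w : Plane → ℝ≥0∞} (hw : Measurable w) :
    ∫⁻ ω, ∑' i, w (X i ω) ∂P = ENNReal.ofReal lam * ∫⁻ y, w y := by
  simpa [expNeg_zero] using h.lintegral_tsum_mul_expNeg (f := fun _ => 0) measurable_const hw

/-- The reduced Campbell formula for exponential functionals. -/
lemma IsMarkedPPP.lintegral_tsum_mul_expNeg_others [IsProbabilityMeasure P]
    (h : IsMarkedPPP P lam ν X g) {f w : Plane → ℝ≥0∞} (hf : Measurable f) (hw : Measurable w)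
    (hfw : ∀ y, w y ≠ 0 → f y ≠ ∞) :
    ∫⁻ ω, ∑' i, w (X i ω) * expNeg (∑' j, if j = i then 0 else f (X j ω)) ∂P =
      (ENNReal.ofReal lam * ∫⁻ y, w y) * expNeg (ENNReal.ofReal lam * ∫⁻ y, (1 - expNeg (f y))) := by
  -- The weight `w e^f` cancels the factor `e^{-f(Xᵢ)}` of the chosen point. This requires `f` to be
  -- finite wherever `w` is nonzero.
  have hk : ∀ y, w y / expNeg (f y) * expNeg (f y) = w y := fun y => by
    rcases eq_or_ne (w y) 0 with h0 | h0
    · simp [h0]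
    · exact ENNReal.div_mul_cancel (fun h1 => hfw y h0 (expNeg_eq_zero.1 h1)) (expNeg_ne_top _)
  have := h.lintegral_tsum_mul_expNeg (k := fun y => w y / expNeg (f y)) hf (by fun_prop)
  simp_rw [hk] at this
  rw [← this]
  congr 1 with ω
  rw [← ENNReal.tsum_mul_right]
  refine tsum_congr fun i => ?_
  rw [ENNReal.tsum_eq_add_tsum_ite (f := fun j => f (X j ω)) i, expNeg_add, ← mul_assoc, hk]
  congr!

/-! ### Functionals that depend on the distance of the chosen point -/

/-- Dyadic approximation of `r` from below. -/
noncomputable def dyadicFloor (n : ℕ) (r : ℝ) : ℝ := (⌊2 ^ n * r⌋₊ : ℝ) / 2 ^ n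

lemma dyadicFloor_nonneg (n : ℕ) (r : ℝ) : 0 ≤ dyadicFloor n r := by
  unfold dyadicFloor; positivity

lemma dyadicFloor_le (n : ℕ) {r : ℝ} (hr : 0 ≤ r) : dyadicFloor n r ≤ r := by
  rw [dyadicFloor, div_le_iff₀ (by positivity), mul_comm r]
  exact Nat.floor_le (by positivity)

lemma dyadicFloor_mono {r : ℝ} (hr : 0 ≤ r) : Monotone fun n => dyadicFloor n r := by
  refine monotone_nat_of_le_succ fun n => ?_
  rw [dyadicFloor, dyadicFloor, div_le_div_iff₀ (by positivity) (by positivity), pow_succ,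
    ← mul_assoc, mul_right_comm]
  gcongr
  have : (⌊2 ^ n * r⌋₊ * 2 : ℕ) ≤ ⌊2 ^ n * 2 * r⌋₊ := by
    refine Nat.le_floor ?_
    push_cast
    linarith [Nat.floor_le (show 0 ≤ 2 ^ n * r by positivity)]
  exact_mod_cast this

lemma tendsto_dyadicFloor {r : ℝ} (hr : 0 ≤ r) :
    Filter.Tendsto (fun n => dyadicFloor n r) Filter.atTop (nhds r) := by
  have h1 : Filter.Tendsto (fun n : ℕ => r - (1 / 2 : ℝ) ^ n) Filter.atTop (nhds r) := by
    simpa using (tendsto_pow_atTop_nhds_zero_of_lt_one (r := (1 / 2 : ℝ)) (by norm_num)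
      (by norm_num)).const_sub r
  refine tendsto_of_tendsto_of_tendsto_of_le_of_le h1 tendsto_const_nhds (fun n => ?_)
    fun n => dyadicFloor_le n hr
  have := Nat.lt_floor_add_one (2 ^ n * r)
  simp only [dyadicFloor]
  rw [le_div_iff₀ (by positivity), sub_mul, ← mul_pow]
  norm_num
  linarith

lemma lintegral_eq_tsum_indicator_floor {E : Type*} [MeasurableSpace E] {μ : Measure E} {k : E → ℕ}
    (hk : Measurable k) {F : E → ℝ≥0∞} (hF : Measurable F) :
    ∫⁻ x, F x ∂μ = ∑' n, ∫⁻ x, (if k x = n then F x else 0) ∂μ := by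
  have hm : ∀ n, Measurable fun x => if k x = n then F x else 0 := fun n =>
    Measurable.ite (hk (measurableSet_singleton n)) hF measurable_const
  rw [← lintegral_tsum fun n => (hm n).aemeasurable]
  congr 1 with x
  rw [tsum_eq_single (k x) fun n hn => if_neg hn.symm, if_pos rfl]

/-- Where `k(Xᵢ) = n` the function `f n` is fixed, so the previous formula applies with `w`
restricted to the level set; the results are summed over `n`. -/
lemma IsMarkedPPP.lintegral_tsum_mul_expNeg_others_nat [IsProbabilityMeasure P]
    (h : IsMarkedPPP P lam ν X g) {f : ℕ → Plane → ℝ≥0∞} {w : Plane → ℝ≥0∞} {k : Plane → ℕ}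
    (hf : ∀ n, Measurable (f n)) (hw : Measurable w) (hk : Measurable k)
    (hfw : ∀ y, f (k y) y ≠ ∞) :
    ∫⁻ ω, ∑' i, w (X i ω) * expNeg (∑' j, if j = i then 0 else f (k (X i ω)) (X j ω)) ∂P =
      ENNReal.ofReal lam *
        ∫⁻ x, w x * expNeg (ENNReal.ofReal lam * ∫⁻ y, (1 - expNeg (f (k x) y))) := by
  have hX := h.measurable_loc
  let W : ℕ → Plane → ℝ≥0∞ := fun n y => if k y = n then w y else 0
  have hW : ∀ n, Measurable (W n) := fun n =>
    Measurable.ite (hk (measurableSet_singleton n)) hw measurable_const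
  have hL : ∀ ω, ∑' i, w (X i ω) * expNeg (∑' j, if j = i then 0 else f (k (X i ω)) (X j ω)) =
      ∑' n, ∑' i, W n (X i ω) * expNeg (∑' j, if j = i then 0 else f n (X j ω)) := fun ω => by
    rw [ENNReal.tsum_comm]
    refine tsum_congr fun i => ?_
    rw [tsum_eq_single (f := fun n => W n (X i ω) *
      expNeg (∑' j, if j = i then 0 else f n (X j ω))) (k (X i ω)) fun n hn => by simp [W, hn.symm]]
    simp [W]
  have hm : ∀ n i, Measurable fun ω => ∑' j, if j = i then 0 else f n (X j ω) := fun n i =>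
    Measurable.tsum fun j => by
      split_ifs
      · exact measurable_const
      · exact (hf n).comp (hX j)
  simp_rw [hL]
  have hWX : ∀ n i, Measurable fun ω => W n (X i ω) := fun n i => (hW n).comp (hX i)
  rw [lintegral_tsum fun n => (Measurable.tsum fun i =>
    (hWX n i).fun_mul (hm n i).expNeg).aemeasurable]
  have hmF : Measurable fun x =>
      w x * expNeg (ENNReal.ofReal lam * ∫⁻ y, (1 - expNeg (f (k x) y))) :=
    hw.mul ((measurable_from_top (f := fun n => expNeg (ENNReal.ofReal lam *
      ∫⁻ y, (1 - expNeg (f n y))))).comp hk)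
  rw [lintegral_eq_tsum_indicator_floor hk hmF, ← ENNReal.tsum_mul_left]
  refine tsum_congr fun n => ?_
  rw [h.lintegral_tsum_mul_expNeg_others (hf n) (hW n), mul_assoc,
    ← lintegral_mul_const _ (hW n)]
  · congr 2 with x
    by_cases hx : k x = n
    · simp [W, hx]
    · simp [W, hx]
  · intro y hy
    by_cases hx : k y = n
    · rw [← hx]; exact hfw y
    · simp [W, hx] at hy

/-- The reduced Campbell formula for exponential functionals of the other points which depend on
the distance of the chosen point from the origin in a nondecreasing, left-continuous way. -/
theorem IsMarkedPPP.lintegral_tsum_mul_expNeg_others_norm [IsProbabilityMeasure P]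
    (h : IsMarkedPPP P lam ν X g) {f : ℝ → Plane → ℝ≥0∞} {w : Plane → ℝ≥0∞}
    (hf : Measurable (Function.uncurry f)) (hw : Measurable w) (hw1 : ∀ y, w y ≤ 1)
    (hmono : ∀ y, MonotoneOn (fun r => f r y) (Ici 0))
    (hcont : ∀ y r, 0 ≤ r → ContinuousWithinAt (fun r => f r y) (Icc 0 r) r)
    (hfin : ∀ y, f ‖y‖ y ≠ ∞) :
    ∫⁻ ω, ∑' i, w (X i ω) * expNeg (∑' j, if j = i then 0 else f ‖X i ω‖ (X j ω)) ∂P =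
      ENNReal.ofReal lam *
        ∫⁻ x, w x * expNeg (ENNReal.ofReal lam * ∫⁻ y, (1 - expNeg (f ‖x‖ y))) := by
  have hX := h.measurable_loc
  have hmul : ∀ {u : Plane → ℝ≥0∞} (_ : Measurable u) (ρ : ℝ → ℝ) (_ : Measurable ρ) (i : ℕ),
      Measurable fun ω => u (X i ω) *
        expNeg (∑' j, if j = i then 0 else f (ρ ‖X i ω‖) (X j ω)) := fun {u} hu ρ hρ i => by
    have h1 : Measurable fun ω => u (X i ω) := hu.comp (hX i)
    refine h1.fun_mul (Measurable.expNeg (Measurable.tsum fun j => ?_))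
    split_ifs
    · exact measurable_const
    · exact hf.comp ((hρ.comp (hX i).norm).prodMk (hX j))
  have hd : ∀ n, Measurable (dyadicFloor n) := fun n => by unfold dyadicFloor; fun_prop
  have hdm : ∀ r y, 0 ≤ r → Monotone fun n => f (dyadicFloor n r) y := fun r y hr m n hmn =>
    hmono y (dyadicFloor_nonneg _ _) (dyadicFloor_nonneg _ _) (dyadicFloor_mono hr hmn)
  -- The dyadic values approach `r` from below, so left-continuity is enough.
  have hds : ∀ r y, 0 ≤ r → ⨆ n, f (dyadicFloor n r) y = f r y := fun r y hr =>
    iSup_eq_of_tendsto (hdm r y hr) ((hcont y r hr).tendsto.comp (tendsto_nhdsWithin_iff.2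
      ⟨tendsto_dyadicFloor hr, Filter.Eventually.of_forall fun n =>
        ⟨dyadicFloor_nonneg _ _, dyadicFloor_le n hr⟩⟩))
  have hmL : ∀ (ρ : ℝ → ℝ) (_ : Measurable ρ),
      Measurable fun x : Plane => ∫⁻ y, (1 - expNeg (f (ρ ‖x‖) y)) := fun ρ hρ => by
    refine Measurable.lintegral_prod_right' (f := fun p : Plane × Plane =>
      1 - expNeg (f (ρ ‖p.1‖) p.2)) ?_
    exact measurable_const.sub
      (hf.comp ((hρ.comp measurable_fst.norm).prodMk measurable_snd)).expNeg
  -- The exponentials decrease along the approximation, and convergence from above needs a finite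
  -- integral; hence integrable weights come first.
  have key : ∀ w : Plane → ℝ≥0∞, Measurable w → ∫⁻ y, w y ≠ ∞ → (∀ y, w y ≤ 1) →
      ∫⁻ ω, ∑' i, w (X i ω) * expNeg (∑' j, if j = i then 0 else f ‖X i ω‖ (X j ω)) ∂P =
      ENNReal.ofReal lam *
        ∫⁻ x, w x * expNeg (ENNReal.ofReal lam * ∫⁻ y, (1 - expNeg (f ‖x‖ y))) := by
    intro w hw hwi hw1
    have hstep : ∀ n, ∑' i, ∫⁻ ω, w (X i ω) *
          expNeg (∑' j, if j = i then 0 else f (dyadicFloor n ‖X i ω‖) (X j ω)) ∂P =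
        ENNReal.ofReal lam * ∫⁻ x, w x * expNeg (ENNReal.ofReal lam *
          ∫⁻ y, (1 - expNeg (f (dyadicFloor n ‖x‖) y))) := fun n => by
      rw [← lintegral_tsum fun i => (hmul hw _ (hd n) i).aemeasurable]
      refine h.lintegral_tsum_mul_expNeg_others_nat (f := fun k => f ((k : ℝ) / 2 ^ n))
        (k := fun y => ⌊2 ^ n * ‖y‖⌋₊) (fun k => hf.comp measurable_prodMk_left) hw
        (Nat.measurable_floor.comp (by fun_prop)) fun y => ?_
      exact ((hmono y (dyadicFloor_nonneg n _) (norm_nonneg y)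
        (dyadicFloor_le n (norm_nonneg y))).trans_lt (hfin y).lt_top).ne
    have hwX : ∑' i, ∫⁻ ω, w (X i ω) ∂P ≠ ∞ := by
      rw [← lintegral_tsum (f := fun i ω => w (X i ω)) fun i => (hw.comp (hX i)).aemeasurable,
        h.campbell_formula hw]
      finiteness
    have hinf : ∀ (a : ℝ≥0∞) (u : ℕ → ℝ≥0∞), a ≤ 1 → a * expNeg (⨆ n, u n) =
        ⨅ n, a * expNeg (u n) := fun a u ha => by
      rw [expNeg_iSup, ENNReal.mul_iInf fun h => absurd h (ha.trans_lt ENNReal.one_lt_top).ne]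
    have hanti : ∀ (a : ℝ≥0∞) {u v : ℝ≥0∞}, u ≤ v → a * expNeg v ≤ a * expNeg u :=
      fun a u v huv => mul_le_mul_right (expNeg_antitone huv) a
    have hmle : ∀ (a : ℝ≥0∞) (u : ℝ≥0∞), a * expNeg u ≤ a :=
      fun a u => mul_le_of_le_one_right' (expNeg_le_one u)
    have hSsup : ∀ i ω, (∑' j, if j = i then 0 else f ‖X i ω‖ (X j ω)) =
        ⨆ n, ∑' j, if j = i then 0 else f (dyadicFloor n ‖X i ω‖) (X j ω) := fun i ω => by
      simp_rw [← lintegral_count]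
      rw [← lintegral_iSup (fun n => measurable_from_top)]
      · congr 1 with j
        split_ifs
        · simp
        · rw [hds _ _ (norm_nonneg _)]
      · intro m n hmn j
        dsimp only
        split_ifs
        · exact le_rfl
        · exact hdm _ _ (norm_nonneg _) hmn
    have hSmono : ∀ i ω, Monotone fun n =>
        ∑' j, if j = i then 0 else f (dyadicFloor n ‖X i ω‖) (X j ω) := fun i ω m n hmn => by
      refine ENNReal.tsum_le_tsum fun j => ?_
      split_ifs
      · exact le_rfl
      · exact hdm _ _ (norm_nonneg _) hmn
    have hLsup : ∀ x : Plane, ENNReal.ofReal lam * ∫⁻ y, (1 - expNeg (f ‖x‖ y)) =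
        ⨆ n, ENNReal.ofReal lam * ∫⁻ y, (1 - expNeg (f (dyadicFloor n ‖x‖) y)) := fun x => by
      rw [← ENNReal.mul_iSup, ← lintegral_iSup]
      · simp_rw [← one_sub_expNeg_iSup, hds _ _ (norm_nonneg x)]
      · exact fun n => measurable_const.sub (hf.comp measurable_prodMk_left).expNeg
      · exact fun m n hmn y => one_sub_expNeg_monotone (hdm _ _ (norm_nonneg _) hmn)
    have hLmono : ∀ x : Plane, Monotone fun n =>
        ENNReal.ofReal lam * ∫⁻ y, (1 - expNeg (f (dyadicFloor n ‖x‖) y)) := fun x m n hmn =>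
      mul_le_mul_right (lintegral_mono fun y =>
        one_sub_expNeg_monotone (hdm _ _ (norm_nonneg _) hmn)) _
    rw [lintegral_tsum fun i => (hmul hw (fun r => r) measurable_id i).aemeasurable]
    have hL : ∑' i, ∫⁻ ω, w (X i ω) *
          expNeg (∑' j, if j = i then 0 else f ‖X i ω‖ (X j ω)) ∂P =
        ⨅ n, ∑' i, ∫⁻ ω, w (X i ω) *
          expNeg (∑' j, if j = i then 0 else f (dyadicFloor n ‖X i ω‖) (X j ω)) ∂P := by
      simp_rw [← lintegral_count (α := ℕ)]
      rw [← lintegral_iInf (fun n => measurable_from_top)]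
      · congr 1 with i
        rw [← lintegral_iInf]
        · simp_rw [lintegral_count, hSsup, hinf _ _ (hw1 _)]
        · simp_rw [lintegral_count]
          exact fun n => hmul hw _ (hd n) i
        · simp_rw [lintegral_count]
          exact fun m n hmn ω => hanti _ (hSmono i ω hmn)
        · exact ((lintegral_mono fun ω => (hmle _ _).trans (hw1 _)).trans_lt (by simp)).ne
      · simp_rw [lintegral_count]
        exact fun m n hmn i => lintegral_mono fun ω => hanti _ (hSmono i ω hmn)
      · rw [lintegral_count]
        exact ((ENNReal.tsum_le_tsum fun i => lintegral_mono fun ω => hmle _ _).trans_lt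
          hwX.lt_top).ne
    have hR : ∫⁻ x, w x * expNeg (ENNReal.ofReal lam * ∫⁻ y, (1 - expNeg (f ‖x‖ y))) =
        ⨅ n, ∫⁻ x, w x * expNeg (ENNReal.ofReal lam *
          ∫⁻ y, (1 - expNeg (f (dyadicFloor n ‖x‖) y))) := by
      rw [← lintegral_iInf]
      · simp_rw [hLsup, hinf _ _ (hw1 _)]
      · exact fun n => hw.mul ((hmL _ (hd n)).const_mul _).expNeg
      · exact fun m n hmn x => hanti _ (hLmono x hmn)
      · exact ((lintegral_mono fun x => hmle _ _).trans_lt hwi.lt_top).ne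
    rw [hL, hR, ENNReal.mul_iInf (by simp)]
    simp_rw [hstep]
  -- A general bounded weight is cut into unit annuli, on each of which it is integrable.
  let k : Plane → ℕ := fun y => ⌊‖y‖⌋₊
  have hk : Measurable k := Nat.measurable_floor.comp measurable_norm
  let W : ℕ → Plane → ℝ≥0∞ := fun n y => if k y = n then w y else 0
  have hW : ∀ n, Measurable (W n) := fun n =>
    Measurable.ite (hk (measurableSet_singleton n)) hw measurable_const
  have hW1 : ∀ n y, W n y ≤ 1 := fun n y => by
    dsimp only [W]
    split_ifs
    · exact hw1 y
    · exact zero_le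
  have hWi : ∀ n, ∫⁻ y, W n y ≠ ∞ := fun n => by
    have : ∀ y, W n y ≤ (Metric.closedBall (0 : Plane) (n + 1)).indicator 1 y := fun y => by
      by_cases hy : k y = n
      · rw [indicator_of_mem]
        · exact hW1 n y
        · rw [mem_closedBall_zero_iff, ← hy]
          exact (Nat.lt_floor_add_one ‖y‖).le
      · simp [W, hy]
    refine ((lintegral_mono this).trans_lt ?_).ne
    rw [lintegral_indicator_one Metric.isClosed_closedBall.measurableSet]
    exact measure_closedBall_lt_top
  have hwW : ∀ y, w y = ∑' n, W n y := fun y => by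
    rw [tsum_eq_single (k y) fun n hn => by simp [W, hn.symm]]
    simp [W]
  simp_rw [hwW, ← ENNReal.tsum_mul_right]
  have hcomm : ∀ ω, (∑' i, ∑' n, W n (X i ω) *
      expNeg (∑' j, if j = i then 0 else f ‖X i ω‖ (X j ω))) = ∑' n, ∑' i, W n (X i ω) *
      expNeg (∑' j, if j = i then 0 else f ‖X i ω‖ (X j ω)) := fun ω => ENNReal.tsum_comm
  simp_rw [hcomm]
  rw [lintegral_tsum fun n => (Measurable.tsum fun i =>
    hmul (hW n) (fun r => r) measurable_id i).aemeasurable, lintegral_tsum fun n =>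
    ((hW n).fun_mul ((hmL (fun r => r) measurable_id).const_mul _).expNeg).aemeasurable, ← ENNReal.tsum_mul_left]
  exact tsum_congr fun n => key _ (hW n) (hWi n) (hW1 n)

end PPP

/-- The σ-algebra `m` is left free so that it can be the one generated by the marks other than `g
i`. -/
lemma measurable_tsum_ofReal_mul_of_ne {Ω : Type*} {m : MeasurableSpace Ω} {g : ℕ → Ω → ℝ}
    {c : ℕ → ℝ≥0∞} {i : ℕ} (hci : c i = 0) (hg : ∀ j, j ≠ i → Measurable (g j)) :
    Measurable fun ω => ∑' j, ENNReal.ofReal (g j ω) * c j := by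
  refine Measurable.tsum fun j => ?_
  by_cases hj : j = i
  · simp [hj, hci]
  · exact (ENNReal.measurable_ofReal.comp (hg j hj)).mul_const _

section PPP

variable {Ω : Type*} [MeasurableSpace Ω] {P : Measure Ω} {lam : ℝ} {ν : Measure ℝ}
    {X : ℕ → Ω → Plane} {g : ℕ → Ω → ℝ}

/-! ### Integrating out the marks -/

/-- `e^{-ψ}` is the Laplace transform of the law `ν` on `[0, ∞)`. -/
def IsLogLaplace (ν : Measure ℝ) (ψ : ℝ≥0∞ → ℝ≥0∞) : Prop :=
  Measurable ψ ∧ ∀ c, c ≠ ∞ → ∫⁻ t, expNeg (ENNReal.ofReal t * c) ∂ν = expNeg (ψ c)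

lemma IsMarkedPPP.lintegral_eq_lintegral_lintegral [IsProbabilityMeasure P]
    (h : IsMarkedPPP P lam ν X g) {F : (ℕ → Plane) → (ℕ → ℝ) → ℝ≥0∞}
    (hF : Measurable (Function.uncurry F)) :
    ∫⁻ ω, F (fun i => X i ω) (fun i => g i ω) ∂P =
      ∫⁻ ω, ∫⁻ ω', F (fun i => X i ω) (fun i => g i ω') ∂P ∂P := by
  have hX : Measurable fun ω i => X i ω := measurable_pi_lambda _ h.measurable_loc
  have hg : Measurable fun ω i => g i ω := measurable_pi_lambda _ h.measurable_mark
  have := (indepFun_iff_map_prod_eq_prod_map_map hX.aemeasurable hg.aemeasurable).1 h.indep_loc_mark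
  have := congrArg (fun μ => ∫⁻ p, Function.uncurry F p ∂μ) this
  have hp : IsProbabilityMeasure (P.map fun ω i => g i ω) :=
    Measure.isProbabilityMeasure_map hg.aemeasurable
  rw [lintegral_map hF (hX.prodMk hg), lintegral_prod _ hF.aemeasurable,
    lintegral_map hF.lintegral_prod_right' hX] at this
  simp only [Function.uncurry] at this
  rw [this]
  congr 1 with ω
  exact lintegral_map (hF.comp measurable_prodMk_left) hg

/-- Independence handles the finite partial sums; the decreasing limit handles the series. -/
lemma IsMarkedPPP.lintegral_expNeg_marks [IsProbabilityMeasure P]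
    (h : IsMarkedPPP P lam ν X g) {ψ : ℝ≥0∞ → ℝ≥0∞} (hψ : IsLogLaplace ν ψ) {c : ℕ → ℝ≥0∞}
    (hc : ∀ j, c j ≠ ∞) :
    ∫⁻ ω, expNeg (∑' j, ENNReal.ofReal (g j ω) * c j) ∂P = expNeg (∑' j, ψ (c j)) := by
  have hg := h.measurable_mark
  simp_rw [ENNReal.tsum_eq_iSup_nat, expNeg_iSup]
  rw [lintegral_iInf]
  · refine iInf_congr fun n => ?_
    simp_rw [expNeg_sum]
    have hi := h.indep_mark.comp (fun j t => expNeg (ENNReal.ofReal t * c j)) fun j => by fun_prop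
    have := lintegral_prod_eq_prod_lintegral_of_indepFun (Finset.range n) _ hi fun j => by
      have := hg j
      simp only [Function.comp_def]
      fun_prop
    simp only [Function.comp_apply] at this
    rw [this]
    refine Finset.prod_congr rfl fun j _ => ?_
    rw [← hψ.2 _ (hc j), ← h.law_mark j, lintegral_map (by fun_prop) (hg j)]
  · intro n
    fun_prop
  · intro m n hmn ω
    exact expNeg_antitone (Finset.sum_le_sum_of_subset (Finset.range_mono hmn))
  · exact ((lintegral_mono fun ω => expNeg_le_one _).trans_lt (by simp)).ne

/-- Fubini: with the locations frozen, the marks are averaged by the preceding lemma. This turns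
marked functionals into functionals of the locations alone. -/
lemma IsMarkedPPP.lintegral_mul_expNeg_marks [IsProbabilityMeasure P]
    (h : IsMarkedPPP P lam ν X g) {ψ : ℝ≥0∞ → ℝ≥0∞} (hψ : IsLogLaplace ν ψ)
    {w : (ℕ → Plane) → ℝ≥0∞} {c : (ℕ → Plane) → ℕ → ℝ≥0∞} (hw : Measurable w)
    (hcm : ∀ j, Measurable fun x => c x j) (hc : ∀ x j, c x j ≠ ∞) :
    ∫⁻ ω, w (fun i => X i ω) *
        expNeg (∑' j, ENNReal.ofReal (g j ω) * c (fun i => X i ω) j) ∂P =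
      ∫⁻ ω, w (fun i => X i ω) * expNeg (∑' j, ψ (c (fun i => X i ω) j)) ∂P := by
  have hg := h.measurable_mark
  rw [h.lintegral_eq_lintegral_lintegral (F := fun x t =>
    w x * expNeg (∑' j, ENNReal.ofReal (t j) * c x j))]
  · congr 1 with ω
    rw [lintegral_const_mul _ (by fun_prop), h.lintegral_expNeg_marks hψ fun j => hc _ j]
  · have h1 : ∀ j, Measurable fun p : (ℕ → Plane) × (ℕ → ℝ) => c p.1 j :=
      fun j => (hcm j).comp measurable_fst
    have h2 : Measurable fun p : (ℕ → Plane) × (ℕ → ℝ) => w p.1 := hw.comp measurable_fst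
    refine h2.fun_mul (Measurable.expNeg (Measurable.tsum fun j => ?_))
    exact (ENNReal.measurable_ofReal.comp
      ((measurable_pi_apply j).comp measurable_snd)).fun_mul (h1 j)

/-! ### Exponential marks -/

lemma expMeasure_Ioi (t : ℝ) (ht : 0 ≤ t) :
    expMeasure 1 (Ioi t) = ENNReal.ofReal (Real.exp (-t)) := by
  have := isProbabilityMeasure_expMeasure one_pos
  have h1 := cdf_expMeasure_eq one_pos t
  rw [if_pos ht, one_mul, cdf_eq_real] at h1
  rw [← compl_Iic, prob_compl_eq_one_sub measurableSet_Iic, ← ENNReal.ofReal_toReal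
    (measure_ne_top (expMeasure 1) (Iic t)), ← ENNReal.ofReal_one,
    ← ENNReal.ofReal_sub _ ENNReal.toReal_nonneg]
  congr 1
  rw [measureReal_def] at h1
  rw [h1]; ring

lemma expMeasure_lt_ofReal (b : ℝ≥0∞) :
    expMeasure 1 {t | b < ENNReal.ofReal t} = expNeg b := by
  rcases eq_or_ne b ∞ with rfl | hb
  · simp [expNeg_top]
  rw [expNeg_of_ne_top hb, ← expMeasure_Ioi _ ENNReal.toReal_nonneg]
  congr 1 with t
  exact ENNReal.lt_ofReal_iff_toReal_lt hb

/-- Because `c i = 0`, the sum involves only the other marks and is independent of `g i`.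
Conditioning on it and using the exponential tail gives its Laplace transform, for all values of the
sum including `∞`. -/
lemma IsMarkedPPP.measure_tsum_marks_lt [IsProbabilityMeasure P]
    (h : IsMarkedPPP P lam (expMeasure 1) X g) {ψ : ℝ≥0∞ → ℝ≥0∞}
    (hψ : IsLogLaplace (expMeasure 1) ψ) {c : ℕ → ℝ≥0∞} (hc : ∀ j, c j ≠ ∞) {i : ℕ}
    (hci : c i = 0) :
    P {ω | ∑' j, ENNReal.ofReal (g j ω) * c j < ENNReal.ofReal (g i ω)} =
      expNeg (∑' j, ψ (c j)) := by
  have hg := h.measurable_mark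
  set I : Ω → ℝ≥0∞ := fun ω => ∑' j, ENNReal.ofReal (g j ω) * c j with hI
  have hIm : Measurable I := by fun_prop
  have hind : IndepFun I (g i) P := by
    rw [IndepFun_iff_Indep]
    have h1 := indep_iSup_of_disjoint (fun j => (hg j).comap_le)
      ((iIndepFun_iff_iIndep ..).1 h.indep_mark) (S := {i}ᶜ) (T := {i}) disjoint_compl_left
    refine indep_of_indep_of_le_left (indep_of_indep_of_le_right h1 ?_) ?_
    · simp
    · refine Measurable.comap_le (measurable_tsum_ofReal_mul_of_ne hci fun j hj => ?_)
      have : MeasurableSpace.comap (g j) inferInstance ≤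
          ⨆ k ∈ ({i}ᶜ : Set ℕ), MeasurableSpace.comap (g k) inferInstance :=
        le_iSup₂_of_le j hj le_rfl
      exact (comap_measurable (g j)).mono this le_rfl
  have hS : MeasurableSet {p : ℝ≥0∞ × ℝ | p.1 < ENNReal.ofReal p.2} :=
    measurableSet_lt measurable_fst (ENNReal.measurable_ofReal.comp measurable_snd)
  have hm := (indepFun_iff_map_prod_eq_prod_map_map hIm.aemeasurable (hg i).aemeasurable).1 hind
  have : P {ω | I ω < ENNReal.ofReal (g i ω)} =
      P.map (fun ω => (I ω, g i ω)) {p : ℝ≥0∞ × ℝ | p.1 < ENNReal.ofReal p.2} := by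
    rw [Measure.map_apply (hIm.prodMk (hg i)) hS]; rfl
  have hp := isProbabilityMeasure_expMeasure one_pos
  rw [this, hm, h.law_mark, Measure.prod_apply hS, lintegral_map (measurable_measure_prodMk_left hS)
    hIm, ← h.lintegral_expNeg_marks hψ hc]
  congr 1 with ω
  exact expMeasure_lt_ofReal _

end PPP

/-! ### The Gamma law -/

lemma lintegral_rpow_mul_exp_neg {a r : ℝ} (ha : 0 < a) (hr : 0 < r) :
    ∫⁻ t in Ioi (0 : ℝ), ENNReal.ofReal (t ^ (a - 1) * Real.exp (-(r * t))) =
      ENNReal.ofReal ((1 / r) ^ a * Real.Gamma a) := by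
  have h := Real.integral_rpow_mul_exp_neg_mul_Ioi ha hr
  rw [← h, ofReal_integral_eq_lintegral_ofReal]
  -- A non-integrable function would have Bochner integral `0`, whereas the known value is positive.
  · by_contra hi
    rw [integral_undef hi] at h
    have := Real.Gamma_pos_of_pos ha
    have : 0 < (1 / r) ^ a * Real.Gamma a := by positivity
    exact this.ne h
  · exact (ae_restrict_iff' measurableSet_Ioi).2 (Filter.Eventually.of_forall fun t ht => by
      have : (0 : ℝ) < t := ht
      positivity)

lemma lintegral_gammaMeasure {m : ℝ} (F : ℝ → ℝ≥0∞) (hF : Measurable F) :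
    ∫⁻ t, F t ∂(gammaMeasure m m) =
      ∫⁻ t in Ioi (0 : ℝ), ENNReal.ofReal (m ^ m / Real.Gamma m * t ^ (m - 1) *
        Real.exp (-(m * t))) * F t := by
  rw [gammaMeasure, lintegral_withDensity_eq_lintegral_mul _ (by unfold gammaPDF; fun_prop) hF,
    ← setLIntegral_congr Ioi_ae_eq_Ici.symm, ← lintegral_indicator measurableSet_Ici]
  congr 1 with t
  by_cases ht : 0 ≤ t
  · rw [indicator_of_mem (mem_Ici.2 ht), Pi.mul_apply, gammaPDF_of_nonneg ht]
  · rw [indicator_of_notMem (by simpa using ht), Pi.mul_apply, gammaPDF_of_neg (not_le.1 ht),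
      zero_mul]

/-- The negative logarithm of the Laplace transform of the Gamma law with shape `m` and mean `1`. -/
noncomputable def gammaLogLaplace (m : ℝ) (c : ℝ≥0∞) : ℝ≥0∞ :=
  ENNReal.ofReal (m * Real.log (1 + c.toReal / m))

lemma expNeg_gammaLogLaplace {m : ℝ} (hm : 0 < m) (c : ℝ≥0∞) :
    expNeg (gammaLogLaplace m c) = ENNReal.ofReal ((1 + c.toReal / m) ^ (-m)) := by
  have h1 : 0 ≤ c.toReal / m := by positivity
  rw [gammaLogLaplace, expNeg_ofReal (mul_nonneg hm.le (Real.log_nonneg (by linarith))),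
    Real.rpow_def_of_pos (by linarith)]
  congr 2
  ring

lemma measurable_gammaLogLaplace (m : ℝ) : Measurable (gammaLogLaplace m) := by
  unfold gammaLogLaplace
  fun_prop

lemma isLogLaplace_gamma {m : ℝ} (hm : 0 < m) :
    IsLogLaplace (gammaMeasure m m) (gammaLogLaplace m) := by
  refine ⟨measurable_gammaLogLaplace m, fun c hc => ?_⟩
  have hG := Real.Gamma_pos_of_pos hm
  have hc0 : 0 ≤ c.toReal := ENNReal.toReal_nonneg
  rw [expNeg_gammaLogLaplace hm, lintegral_gammaMeasure _ (by fun_prop)]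
  have : ∀ t ∈ Ioi (0 : ℝ), ENNReal.ofReal (m ^ m / Real.Gamma m * t ^ (m - 1) *
        Real.exp (-(m * t))) * expNeg (ENNReal.ofReal t * c) =
      ENNReal.ofReal (m ^ m / Real.Gamma m) *
        ENNReal.ofReal (t ^ (m - 1) * Real.exp (-((m + c.toReal) * t))) := fun t ht => by
    have ht : 0 < t := ht
    conv_lhs => rw [← ENNReal.ofReal_toReal hc]
    rw [← ENNReal.ofReal_mul ht.le, expNeg_ofReal (by positivity),
      ← ENNReal.ofReal_mul (by positivity), ← ENNReal.ofReal_mul (by positivity)]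
    congr 1
    rw [mul_assoc, mul_assoc, ← Real.exp_add]
    ring_nf
  rw [setLIntegral_congr_fun measurableSet_Ioi this, lintegral_const_mul _ (by fun_prop),
    lintegral_rpow_mul_exp_neg hm (by positivity), ← ENNReal.ofReal_mul (by positivity)]
  congr 1
  have h1 : 1 + c.toReal / m = (m + c.toReal) / m := by field_simp
  rw [h1, Real.rpow_neg (by positivity), Real.div_rpow (by positivity) hm.le,
    Real.div_rpow zero_le_one (by positivity), Real.one_rpow]
  have : 0 < (m + c.toReal) ^ m := by positivity
  have : 0 < m ^ m := by positivity
  field_simp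

/-! ### Integrals over the plane -/

lemma volume_setOf_lt_mul_norm_rpow {α : ℝ} (hα : 0 < α) {K u : ℝ} (hK : 0 ≤ K) (hu : 0 < u) :
    volume {y : Plane | u < K * ‖y‖ ^ (-α)} =
      ENNReal.ofReal (Real.pi * K ^ (2 / α) * u ^ (-(2 / α))) := by
  have h0 : volume ({0} : Set Plane) = 0 := measure_singleton _
  -- The origin drops out because real powers satisfy `0 ^ (-α) = 0`; being a null set, it does not
  -- affect the area.
  have hset : {y : Plane | u < K * ‖y‖ ^ (-α)} = Metric.ball 0 ((K / u) ^ (1 / α)) \ {0} := by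
    ext y
    rcases eq_or_ne y 0 with rfl | hy
    · simp [Real.zero_rpow (neg_ne_zero.2 hα.ne'), hu.le]
    have hy' : 0 < ‖y‖ := norm_pos_iff.2 hy
    have hya : 0 < ‖y‖ ^ α := by positivity
    simp only [mem_ofPred_eq, mem_sdiff, mem_ball_zero_iff, mem_singleton_iff, hy, not_false_eq_true,
      and_true]
    rw [one_div, Real.lt_rpow_inv_iff_of_pos hy'.le (by positivity) hα, lt_div_iff₀ hu,
      Real.rpow_neg hy'.le, ← div_eq_mul_inv, lt_div_iff₀ hya, mul_comm]
  rw [hset, measure_sdiff_null h0, EuclideanSpace.volume_ball_fin_two,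
    ← ENNReal.ofReal_pow (by positivity), ← ENNReal.ofReal_mul (by positivity)]
  congr 1
  rw [← Real.rpow_natCast, ← Real.rpow_mul (by positivity), Real.div_rpow hK hu.le,
    Real.rpow_neg hu.le]
  push_cast
  rw [show 1 / α * 2 = 2 / α by ring]
  ring

/-- Layer-cake form: after exchanging integrals, an integral of `1 - e^{-a(y)}` only requires the
areas of the sets `{u < a(y)}`. -/
lemma one_sub_expNeg_ofReal_eq_lintegral {a : ℝ} (ha : 0 ≤ a) :
    1 - expNeg (ENNReal.ofReal a) =
      ∫⁻ u in Ioi (0 : ℝ), if u < a then ENNReal.ofReal (Real.exp (-u)) else 0 := by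
  have h1 : ∀ u, (if u < a then ENNReal.ofReal (Real.exp (-u)) else 0) =
      (Iio a).indicator (fun u => ENNReal.ofReal (Real.exp (-u))) u := fun u => by
    simp [indicator_apply]
  simp_rw [h1]
  rw [setLIntegral_indicator measurableSet_Iio, Set.inter_comm, Ioi_inter_Iio,
    setLIntegral_congr Ioo_ae_eq_Ioc, ← ofReal_integral_eq_lintegral_ofReal,
    ← intervalIntegral.integral_of_le ha, expNeg_ofReal ha]
  · rw [← ENNReal.ofReal_one, ← ENNReal.ofReal_sub _ (Real.exp_nonneg _)]
    congr 1
    have : ∀ u ∈ uIcc 0 a, HasDerivAt (fun u => -Real.exp (-u)) (Real.exp (-u)) u := fun u _ => by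
      simpa using! ((hasDerivAt_id u).neg.exp).neg
    rw [intervalIntegral.integral_eq_sub_of_hasDerivAt this
      (Continuous.intervalIntegrable (by fun_prop) _ _)]
    simp
    ring
  · exact (Continuous.integrableOn_Icc (by fun_prop)).mono_set Ioc_subset_Icc_self
  · exact Filter.Eventually.of_forall fun u => (Real.exp_nonneg _)

/-- The superlevel areas are `π K^{2/α} u^{-2/α}`, and integrating against `e^{-u}` gives `Γ(1 -
2/α)`; convergence at `u = 0` is where `α > 2` enters. -/
lemma lintegral_one_sub_expNeg_norm_rpow {α : ℝ} (hα : 2 < α) {K : ℝ} (hK : 0 ≤ K) :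
    ∫⁻ y : Plane, (1 - expNeg (ENNReal.ofReal (K * ‖y‖ ^ (-α)))) =
      ENNReal.ofReal (Real.pi * Real.Gamma (1 - 2 / α) * K ^ (2 / α)) := by
  have hδ : 2 / α < 1 := (div_lt_one (by linarith)).2 hα
  have hα0 : 0 < α := by linarith
  have h1 : ∀ y : Plane, 1 - expNeg (ENNReal.ofReal (K * ‖y‖ ^ (-α))) = _ := fun y =>
    one_sub_expNeg_ofReal_eq_lintegral (by positivity)
  simp_rw [h1]
  have hS : MeasurableSet {p : Plane × ℝ | p.2 < K * ‖p.1‖ ^ (-α)} :=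
    measurableSet_lt measurable_snd (by fun_prop)
  rw [lintegral_lintegral_swap (Measurable.aemeasurable
    (Measurable.ite hS (by fun_prop) measurable_const))]
  have h2 : ∀ u ∈ Ioi (0 : ℝ), ∫⁻ y : Plane,
      (if u < K * ‖y‖ ^ (-α) then ENNReal.ofReal (Real.exp (-u)) else 0) =
      ENNReal.ofReal (Real.pi * K ^ (2 / α)) *
        ENNReal.ofReal (u ^ (1 - 2 / α - 1) * Real.exp (-(1 * u))) := fun u hu => by
    have h3 : ∀ y : Plane, (if u < K * ‖y‖ ^ (-α) then ENNReal.ofReal (Real.exp (-u)) else 0) =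
        {y : Plane | u < K * ‖y‖ ^ (-α)}.indicator (fun _ => ENNReal.ofReal (Real.exp (-u))) y :=
      fun y => by simp [indicator_apply]
    have hu : 0 < u := hu
    simp_rw [h3]
    rw [lintegral_indicator_const (measurableSet_lt measurable_const (by fun_prop)),
      volume_setOf_lt_mul_norm_rpow hα0 hK hu, ← ENNReal.ofReal_mul (by positivity),
      ← ENNReal.ofReal_mul (by positivity)]
    congr 1
    rw [show 1 - 2 / α - 1 = -(2 / α) by ring]
    ring_nf
  rw [setLIntegral_congr_fun measurableSet_Ioi h2, lintegral_const_mul _ (by fun_prop),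
    lintegral_rpow_mul_exp_neg (by linarith) one_pos, ← ENNReal.ofReal_mul (by positivity)]
  congr 1
  simp
  ring

/-- The recurrence `Γ(s + 1) = s Γ(s)` at `s = -2/α` removes the Gamma value at a negative argument,
and makes positivity visible. -/
lemma two_mul_zetaFun {α m : ℝ} (hα : 2 < α) :
    2 * zetaFun α m = Real.Gamma (1 - 2 / α) * Real.Gamma (m + 2 / α) / Real.Gamma m := by
  have hα0 : α ≠ 0 := by linarith
  have h := Real.Gamma_add_one (s := -(2 / α)) (neg_ne_zero.2 (by positivity))
  rw [show -(2 / α) + 1 = 1 - 2 / α by ring] at h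
  rw [h, zetaFun]
  field_simp

/-- The integrand is an average over a Gamma mark `t`. Integrating over the plane first leaves a
multiple of the moment `E[t^{2/α}] = Γ(m + 2/α) / (Γ(m) m^{2/α})`. -/
lemma lintegral_one_sub_expNeg_gammaLogLaplace {α m s : ℝ} (hα : 2 < α) (hm : 0 < m) (hs : 0 ≤ s) :
    ∫⁻ y : Plane, (1 - expNeg (gammaLogLaplace m (ENNReal.ofReal (s * ‖y‖ ^ (-α))))) =
      ENNReal.ofReal (Real.pi * (2 * zetaFun α m) * (s / m) ^ (2 / α)) := by
  have hδ : 2 / α < 1 := (div_lt_one (by linarith)).2 hα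
  have hα0 : 0 < α := by linarith
  have hδ0 : 0 < 2 / α := by positivity
  have hG := Real.Gamma_pos_of_pos hm
  have hG1 := Real.Gamma_pos_of_pos (show 0 < 1 - 2 / α by linarith)
  have hp := isProbabilityMeasure_gammaMeasure hm hm
  have h1 : ∀ y : Plane, 1 - expNeg (gammaLogLaplace m (ENNReal.ofReal (s * ‖y‖ ^ (-α)))) =
      ∫⁻ t, (1 - expNeg (ENNReal.ofReal t * ENNReal.ofReal (s * ‖y‖ ^ (-α))))
        ∂(gammaMeasure m m) := fun y => by
    rw [lintegral_sub (by fun_prop), (isLogLaplace_gamma hm).2 _ ENNReal.ofReal_ne_top]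
    · simp
    · exact ((lintegral_mono fun ω => expNeg_le_one _).trans_lt (by simp)).ne
    · exact Filter.Eventually.of_forall fun _ => expNeg_le_one _
  simp_rw [h1]
  rw [lintegral_lintegral_swap (by fun_prop), lintegral_gammaMeasure _ (by fun_prop)]
  have h2 : ∀ t ∈ Ioi (0 : ℝ), ENNReal.ofReal (m ^ m / Real.Gamma m * t ^ (m - 1) *
        Real.exp (-(m * t))) *
        ∫⁻ y : Plane, (1 - expNeg (ENNReal.ofReal t * ENNReal.ofReal (s * ‖y‖ ^ (-α)))) =
      ENNReal.ofReal (m ^ m / Real.Gamma m * (Real.pi * Real.Gamma (1 - 2 / α) * s ^ (2 / α))) *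
        ENNReal.ofReal (t ^ (m + 2 / α - 1) * Real.exp (-(m * t))) := fun t ht => by
    have ht : 0 < t := ht
    simp_rw [← ENNReal.ofReal_mul ht.le, ← mul_assoc]
    rw [lintegral_one_sub_expNeg_norm_rpow hα (by positivity), ← ENNReal.ofReal_mul (by positivity),
      ← ENNReal.ofReal_mul (by positivity)]
    congr 1
    rw [Real.mul_rpow ht.le hs, show m + 2 / α - 1 = (m - 1) + 2 / α by ring, Real.rpow_add ht]
    ring
  rw [setLIntegral_congr_fun measurableSet_Ioi h2, lintegral_const_mul _ (by fun_prop),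
    lintegral_rpow_mul_exp_neg (by linarith) hm, ← ENNReal.ofReal_mul (by positivity),
    two_mul_zetaFun hα]
  congr 1
  rw [Real.div_rpow hs hm.le, Real.div_rpow zero_le_one hm.le, Real.rpow_add hm, Real.one_rpow]
  have : 0 < m ^ m := by positivity
  have : 0 < m ^ (2 / α) := by positivity
  field_simp

/-! ### The hypergeometric function -/

/-- The slit plane `ℂ \ [1, ∞)`. -/
def gaussDomain : Set ℂ := {z : ℂ | 1 - z ∈ Complex.slitPlane}

lemma isOpen_gaussDomain : IsOpen gaussDomain :=
  Complex.isOpen_slitPlane.preimage (by fun_prop)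

lemma one_sub_mul_mem_slitPlane {z : ℂ} (hz : z ∈ gaussDomain) {t : ℝ} (ht : t ∈ Icc (0 : ℝ) 1) :
    1 - z * t ∈ Complex.slitPlane := by
  have := Complex.starConvex_one_slitPlane hz (sub_nonneg.2 ht.2) ht.1 (by ring)
  convert this using 1
  simp
  ring

lemma isPreconnected_gaussDomain : IsPreconnected gaussDomain := by
  have h : StarConvex ℝ (0 : ℂ) gaussDomain := by
    refine starConvex_zero_iff.2 fun z hz t h0 h1 => ?_
    have := one_sub_mul_mem_slitPlane hz (t := t) ⟨h0, h1⟩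
    simpa [gaussDomain, mul_comm] using this
  exact (StarConvex.isPathConnected h (by simp [gaussDomain])).isConnected.isPreconnected

lemma ball_subset_gaussDomain : Metric.ball (0 : ℂ) 1 ⊆ gaussDomain := fun z hz => by
  refine Or.inl ?_
  have h1 := Complex.re_le_norm z
  have h2 : ‖z‖ < 1 := by simpa using hz
  simp
  linarith

/-- Identity theorem on the slit plane, which is star-shaped about `0`. Hence the value of
`gauss2F1` does not depend on the continuation chosen. -/
lemma IsGaussContinuation.eqOn {a b c : ℂ} {F G : ℂ → ℂ} (hF : IsGaussContinuation a b c F)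
    (hG : IsGaussContinuation a b c G) : EqOn F G gaussDomain := by
  refine AnalyticOnNhd.eqOn_of_preconnected_of_eventuallyEq
    (DifferentiableOn.analyticOnNhd hF.1 isOpen_gaussDomain)
    (DifferentiableOn.analyticOnNhd hG.1 isOpen_gaussDomain) isPreconnected_gaussDomain
    (ball_subset_gaussDomain (Metric.mem_ball_self one_pos)) ?_
  filter_upwards [Metric.ball_mem_nhds (0 : ℂ) one_pos] with z hz
  rw [hF.2 z hz, hG.2 z hz]

lemma gauss2F1_eq {a b c : ℂ} {F : ℂ → ℂ} (hF : IsGaussContinuation a b c F) {z : ℂ}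
    (hz : z ∈ gaussDomain) : gauss2F1 a b c z = F z := by
  have h : ∃ F : ℂ → ℂ, IsGaussContinuation a b c F := ⟨F, hF⟩
  rw [gauss2F1, dif_pos h]
  exact h.choose_spec.eqOn hF hz

/-- `1 - (1 - z t)^{-m}`. -/
noncomputable def gaussKernel (m : ℝ) (z : ℂ) (t : ℝ) : ℂ := 1 - (1 - z * t) ^ (-m : ℂ)

/-- Euler-type integral for `₂F₁(m, -δ; 1 - δ; z)`. -/
noncomputable def gaussIntegral (m δ : ℝ) (z : ℂ) : ℂ :=
  1 + δ * ∫ t in Ioc (0 : ℝ) 1, ((t ^ (-δ - 1) : ℝ) : ℂ) * gaussKernel m z t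

lemma hasDerivAt_gaussKernel (m : ℝ) {z : ℂ} (hz : z ∈ gaussDomain) {t : ℝ}
    (ht : t ∈ Icc (0 : ℝ) 1) :
    HasDerivAt (fun z => gaussKernel m z t) (-(m * t * (1 - z * t) ^ (-m - 1 : ℂ))) z := by
  have h1 : HasDerivAt (fun z : ℂ => 1 - z * t) (-(t : ℂ)) z := by
    simpa using ((hasDerivAt_id z).mul_const (t : ℂ)).const_sub 1
  have := (h1.cpow_const (c := (-m : ℂ)) (one_sub_mul_mem_slitPlane hz ht)).const_sub 1
  exact this.congr_deriv (by ring)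

/-- The factor `t` from the chain rule offsets the singularity `t^{-δ-1}`. The bound, uniform on
compacts, serves both the mean value inequality and differentiation under the integral. -/
lemma exists_bound_gaussKernel_deriv (m : ℝ) {K : Set ℂ} (hK : IsCompact K) (hKU : K ⊆ gaussDomain) :
    ∃ C, 0 ≤ C ∧ ∀ z ∈ K, ∀ t ∈ Icc (0 : ℝ) 1,
      ‖-((m : ℂ) * t * (1 - z * t) ^ (-m - 1 : ℂ))‖ ≤ C * t := by
  have hc : ContinuousOn (fun p : ℂ × ℝ => (m : ℂ) * (1 - p.1 * p.2) ^ (-m - 1 : ℂ))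
      (K ×ˢ Icc (0 : ℝ) 1) := by
    refine continuousOn_const.mul (ContinuousOn.cpow_const (by fun_prop) fun p hp => ?_)
    exact one_sub_mul_mem_slitPlane (hKU hp.1) hp.2
  obtain ⟨C, hC⟩ := (hK.prod isCompact_Icc).exists_bound_of_continuousOn hc
  refine ⟨max C 0, le_max_right _ _, fun z hz t ht => ?_⟩
  have := (hC (z, t) ⟨hz, ht⟩).trans (le_max_left C 0)
  rw [norm_neg, mul_right_comm, norm_mul, Complex.norm_real, Real.norm_of_nonneg ht.1]
  exact mul_le_mul_of_nonneg_right this ht.1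

lemma measurable_gaussKernel (m : ℝ) (z : ℂ) : Measurable (gaussKernel m z) := by
  unfold gaussKernel
  fun_prop

lemma integrableOn_rpow_Ioc {a : ℝ} (ha : -1 < a) : IntegrableOn (fun t : ℝ => t ^ a) (Ioc 0 1) :=
  (intervalIntegrable_iff_integrableOn_Ioc_of_le zero_le_one).1
    (intervalIntegral.intervalIntegrable_rpow' ha)

/-- Mean value inequality along the segment from `0`, where the kernel vanishes, to `z`. Subtracting
`1` thus regularises the Euler integral, which diverges at `t = 0` for the parameter `-δ < 0`. -/
lemma exists_bound_gaussKernel (m : ℝ) {z : ℂ} (hz : z ∈ gaussDomain) :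
    ∃ C, ∀ t ∈ Icc (0 : ℝ) 1, ‖gaussKernel m z t‖ ≤ C * t := by
  have hseg : segment ℝ 0 z ⊆ gaussDomain := by
    rw [segment_eq_image]
    rintro _ ⟨u, hu, rfl⟩
    have := one_sub_mul_mem_slitPlane hz hu
    simpa [gaussDomain, mul_comm] using this
  have hcomp : IsCompact (segment ℝ 0 z) := by
    rw [segment_eq_image]
    exact isCompact_Icc.image (by fun_prop)
  obtain ⟨C, -, hC⟩ := exists_bound_gaussKernel_deriv m hcomp hseg
  refine ⟨C * ‖z‖, fun t ht => ?_⟩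
  have := (convex_segment (0 : ℂ) z).norm_image_sub_le_of_norm_hasDerivWithin_le
    (fun w hw => (hasDerivAt_gaussKernel m (hseg hw) ht).hasDerivWithinAt)
    (fun w hw => hC w hw t ht) (left_mem_segment ℝ 0 z) (right_mem_segment ℝ 0 z)
  simp only [gaussKernel, zero_mul, sub_zero, Complex.one_cpow, sub_self] at this
  rw [gaussKernel]
  linarith

lemma rpow_sub_one_mul (δ : ℝ) {t : ℝ} (ht : 0 < t) : t ^ (-δ - 1) * t = t ^ (-δ) := by
  rw [Real.rpow_sub_one ht.ne', div_mul_cancel₀ _ ht.ne']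

lemma integrableOn_gaussIntegrand (m : ℝ) {δ : ℝ} (hδ : δ < 1) {z : ℂ} (hz : z ∈ gaussDomain) :
    IntegrableOn (fun t : ℝ => ((t ^ (-δ - 1) : ℝ) : ℂ) * gaussKernel m z t) (Ioc 0 1) := by
  obtain ⟨C, hC⟩ := exists_bound_gaussKernel m hz
  refine Integrable.mono' ((integrableOn_rpow_Ioc (a := -δ) (by linarith)).const_mul C)
    (Measurable.aestronglyMeasurable ?_) ?_
  · have := measurable_gaussKernel m z
    fun_prop
  · refine (ae_restrict_iff' measurableSet_Ioc).2 (Filter.Eventually.of_forall fun t ht => ?_)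
    have h0 : 0 < t := ht.1
    rw [norm_mul, Complex.norm_real, Real.norm_of_nonneg (by positivity), ← rpow_sub_one_mul δ h0]
    calc _ ≤ t ^ (-δ - 1) * (C * t) := by gcongr; exact hC t ⟨h0.le, ht.2⟩
      _ = _ := by ring

lemma differentiableOn_gaussIntegral (m : ℝ) {δ : ℝ} (hδ : δ < 1) :
    DifferentiableOn ℂ (gaussIntegral m δ) gaussDomain := by
  intro z hz
  obtain ⟨ε, hε, hball⟩ := Metric.nhds_basis_closedBall.mem_iff.1 (isOpen_gaussDomain.mem_nhds hz)
  obtain ⟨C, hC0, hC⟩ := exists_bound_gaussKernel_deriv m (isCompact_closedBall z ε) hball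
  have := hasDerivAt_integral_of_dominated_loc_of_deriv_le (𝕜 := ℂ)
    (μ := volume.restrict (Ioc (0 : ℝ) 1)) (x₀ := z) (s := Metric.ball z ε)
    (F := fun z t => ((t ^ (-δ - 1) : ℝ) : ℂ) * gaussKernel m z t)
    (F' := fun z t => ((t ^ (-δ - 1) : ℝ) : ℂ) * (-(m * t * (1 - z * t) ^ (-m - 1 : ℂ))))
    (bound := fun t => C * t ^ (-δ)) (Metric.ball_mem_nhds z hε)
    (Filter.Eventually.of_forall fun w => by
      have := measurable_gaussKernel m w
      exact Measurable.aestronglyMeasurable (by fun_prop))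
    (integrableOn_gaussIntegrand m hδ hz)
    (Measurable.aestronglyMeasurable (by fun_prop)) ?_
    ((integrableOn_rpow_Ioc (a := -δ) (by linarith)).const_mul C) ?_
  · exact ((this.2.const_mul (δ : ℂ)).const_add 1).differentiableAt.differentiableWithinAt
  · refine (ae_restrict_iff' measurableSet_Ioc).2 (Filter.Eventually.of_forall fun t ht w hw => ?_)
    have h0 : 0 < t := ht.1
    rw [norm_mul, Complex.norm_real, Real.norm_of_nonneg (by positivity), ← rpow_sub_one_mul δ h0]
    calc _ ≤ t ^ (-δ - 1) * (C * t) := by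
          gcongr; exact hC w (Metric.ball_subset_closedBall hw) t ⟨h0.le, ht.2⟩
      _ = _ := by ring
  · refine (ae_restrict_iff' measurableSet_Ioc).2 (Filter.Eventually.of_forall fun t ht w hw => ?_)
    exact (hasDerivAt_gaussKernel m (hball (Metric.ball_subset_closedBall hw))
      ⟨ht.1.le, ht.2⟩).const_mul _

lemma hasSum_binomial (m : ℝ) {z : ℂ} (hz : ‖z‖ < 1) :
    HasSum (fun k : ℕ => Ring.choose ((m : ℂ) + k - 1) k * z ^ k) ((1 - z) ^ (-m : ℂ)) := by
  have := (Complex.one_div_one_sub_cpow_hasFPowerSeriesOnBall_zero (m : ℂ)).hasSum (y := z)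
    (by simpa [← ofReal_norm, ENNReal.ofReal_lt_one] using hz)
  simp only [zero_add, FormalMultilinearSeries.ofScalars_apply_eq, smul_eq_mul, one_div,
    ← Complex.cpow_neg] at this
  exact this

lemma summable_norm_binomial (m : ℝ) {z : ℂ} (hz : ‖z‖ < 1) :
    Summable fun k : ℕ => ‖Ring.choose ((m : ℂ) + k - 1) k * z ^ k‖ := 
  (hasSum_binomial m hz).summable.norm

lemma choose_eq_ascPochhammer (m : ℂ) (k : ℕ) :
    Ring.choose (m + k - 1) k = (k.factorial : ℂ)⁻¹ * (ascPochhammer ℂ k).eval m := by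
  have h := Ring.factorial_nsmul_multichoose_eq_ascPochhammer m k
  have hk : (k.factorial : ℂ) ≠ 0 := by exact_mod_cast k.factorial_ne_zero
  rw [← Ring.multichoose_eq, eq_inv_mul_iff_mul_eq₀ hk, ← nsmul_eq_mul, h,
    Polynomial.ascPochhammer_smeval_eq_eval]

lemma ascPochhammer_neg_mul {δ : ℂ} (k : ℕ) :
    (ascPochhammer ℂ k).eval (-δ) * (k - δ) = -δ * (ascPochhammer ℂ k).eval (1 - δ) := by
  have h1 := ascPochhammer_succ_eval k (-δ)
  have h2 : (ascPochhammer ℂ (k + 1)).eval (-δ) = -δ * (ascPochhammer ℂ k).eval (1 - δ) := by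
    rw [ascPochhammer_succ_left]
    simp [Polynomial.eval_comp]
    ring_nf
    simp
  rw [← h2, h1]
  ring

lemma gaussIntegral_eq_ordinaryHypergeometric (m : ℝ) {δ : ℝ} (hδ0 : 0 < δ) (hδ : δ < 1) {z : ℂ}
    (hz : ‖z‖ < 1) :
    gaussIntegral m δ z = ordinaryHypergeometric (m : ℂ) ((-δ : ℝ) : ℂ) ((1 - δ : ℝ) : ℂ) z := by
  let a : ℕ → ℂ := fun k => Ring.choose ((m : ℂ) + k - 1) k * z ^ k
  have ha0 : a 0 = 1 := by simp [a]
  have hkδ : ∀ k : ℕ, ((k : ℂ) - δ) ≠ 0 := fun k hk => by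
    have h1 : (k : ℝ) = δ := by exact_mod_cast sub_eq_zero.1 hk
    rcases k with _ | k
    · simp at h1; linarith
    · push_cast at h1; linarith [k.cast_nonneg (α := ℝ)]
  have hasum := summable_norm_binomial m hz
  -- Since the parameters `-δ` and `1 - δ` differ by one, their Pochhammer ratio collapses to `-δ /
  -- (k - δ)`.
  have hterm : ∀ k : ℕ, ((k.factorial : ℂ)⁻¹ * (ascPochhammer ℂ k).eval (m : ℂ) *
      (ascPochhammer ℂ k).eval ((-δ : ℝ) : ℂ) * ((ascPochhammer ℂ k).eval ((1 - δ : ℝ) : ℂ))⁻¹) • z ^ k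
      = a k * (-δ / (k - δ)) := fun k => by
    have hne : (ascPochhammer ℂ k).eval ((1 : ℂ) - δ) ≠ 0 := by
      rw [Ne, ascPochhammer_eval_eq_zero_iff]
      rintro ⟨j, -, hj⟩
      refine hkδ (j + 1) ?_
      push_cast
      linear_combination hj
    simp only [a, choose_eq_ascPochhammer, smul_eq_mul]
    push_cast
    have := ascPochhammer_neg_mul (δ := (δ : ℂ)) k
    have h3 := hkδ k
    rw [show (ascPochhammer ℂ k).eval (-(δ : ℂ)) = -δ * (ascPochhammer ℂ k).eval (1 - (δ : ℂ)) /
      (k - δ) by rw [← this]; field_simp]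
    field_simp
  rw [ordinaryHypergeometric, ordinaryHypergeometric_sum_eq]
  simp_rw [hterm]
  -- The kernel is expanded binomially and integrated term by term. Its constant term cancels, hence
  -- the shift to `k + 1`; the missing `k = 0` term is the leading `1` of `gaussIntegral`.
  have hint : HasSum (fun k : ℕ => a (k + 1) * (-δ / ((k + 1 : ℕ) - δ)))
      (δ * ∫ t in Ioc (0 : ℝ) 1, ((t ^ (-δ - 1) : ℝ) : ℂ) * gaussKernel m z t) := by
    let F : ℕ → ℝ → ℂ := fun k t => -a (k + 1) * ((t ^ ((k : ℝ) - δ) : ℝ) : ℂ)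
    have hkgt : ∀ k : ℕ, -1 < (k : ℝ) - δ := fun k => by linarith [k.cast_nonneg (α := ℝ)]
    have hFi : ∀ k, Integrable (F k) (volume.restrict (Ioc (0 : ℝ) 1)) := fun k =>
      ((integrableOn_rpow_Ioc (hkgt k)).ofReal).const_mul _
    have hri : ∀ k : ℕ, ∫ t in Ioc (0 : ℝ) 1, t ^ ((k : ℝ) - δ) = 1 / (k + 1 - δ) := fun k => by
      rw [← intervalIntegral.integral_of_le zero_le_one, integral_rpow (Or.inl (hkgt k)),
        Real.one_rpow, Real.zero_rpow (by linarith [hkgt k]), sub_zero]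
      congr 1; ring
    have hFn : Summable fun k => ∫ t in Ioc (0 : ℝ) 1, ‖F k t‖ := by
      have h1 : ∀ k, ∫ t in Ioc (0 : ℝ) 1, ‖F k t‖ = ‖a (k + 1)‖ * (1 / (k + 1 - δ)) := fun k => by
        rw [← hri, ← integral_const_mul]
        refine setIntegral_congr_fun measurableSet_Ioc fun t ht => ?_
        have : 0 < t := ht.1
        simp only [F, norm_mul, norm_neg, Complex.norm_real]
        rw [Real.norm_of_nonneg (by positivity)]
      simp_rw [h1]
      refine Summable.of_nonneg_of_le (fun k => ?_) (fun k => ?_)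
        (((summable_nat_add_iff 1).2 hasum).mul_right (1 / (1 - δ)))
      · have := hkgt k
        exact mul_nonneg (norm_nonneg _) (one_div_nonneg.2 (by linarith))
      · have := k.cast_nonneg (α := ℝ)
        have : 0 < 1 - δ := by linarith
        exact mul_le_mul_of_nonneg_left (one_div_le_one_div_of_le this (by linarith))
          (norm_nonneg _)
    have hs := (hasSum_integral_of_summable_integral_norm hFi hFn).mul_left (δ : ℂ)
    convert! hs using 1
    · ext k
      rw [integral_const_mul, integral_complex_ofReal, hri]
      push_cast
      ring
    · congr 1
      refine setIntegral_congr_fun measurableSet_Ioc fun t ht => ?_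
      have ht0 : 0 < t := ht.1
      have hzt : ‖z * t‖ < 1 := by
        rw [norm_mul, Complex.norm_real, Real.norm_of_nonneg ht0.le]
        nlinarith [norm_nonneg z, ht.2]
      have h1 := hasSum_binomial m hzt
      have h2 := ((hasSum_nat_add_iff' 1).2 h1).neg.mul_left (((t ^ (-δ - 1) : ℝ) : ℂ))
      simp only [Finset.range_one, Finset.sum_singleton, pow_zero, Ring.choose_zero_right, mul_one,
        neg_sub] at h2
      rw [gaussKernel, ← h2.tsum_eq]
      refine tsum_congr fun k => ?_
      simp only [F, a]
      have h3 : t ^ ((k : ℝ) - δ) = t ^ (-δ - 1) * t ^ (k + 1) := by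
        rw [← Real.rpow_natCast, ← Real.rpow_add ht0]
        push_cast; ring_nf
      rw [h3, mul_pow]
      push_cast
      ring
  have hall := (hasSum_nat_add_iff (f := fun k : ℕ => a k * (-δ / ((k : ℂ) - δ))) 1).1
    (by exact_mod_cast hint)
  rw [hall.tsum_eq, gaussIntegral]
  have : (δ : ℂ) ≠ 0 := by exact_mod_cast hδ0.ne'
  simp [ha0, add_comm, this]

lemma isGaussContinuation_gaussIntegral (m : ℝ) {δ : ℝ} (hδ0 : 0 < δ) (hδ : δ < 1) :
    IsGaussContinuation (m : ℂ) ((-δ : ℝ) : ℂ) ((1 - δ : ℝ) : ℂ) (gaussIntegral m δ) :=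
  ⟨differentiableOn_gaussIntegral m hδ, fun z hz =>
    gaussIntegral_eq_ordinaryHypergeometric m hδ0 hδ (by simpa using hz)⟩

/-- Integral representation of `η`. -/
lemma eta_eq {α s m r : ℝ} (hα : 2 < α) (hx : 0 ≤ s / (m * r ^ α)) :
    eta α s m r = 1 + 2 / α * ∫ t in Ioc (0 : ℝ) 1,
      t ^ (-(2 / α) - 1) * (1 - (1 + s / (m * r ^ α) * t) ^ (-m)) := by
  have hδ : 2 / α < 1 := (div_lt_one (by linarith)).2 hα
  have hδ0 : 0 < 2 / α := by have : 0 < α := by linarith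
                             positivity
  have hz : ((-(s / (m * r ^ α)) : ℝ) : ℂ) ∈ gaussDomain := by
    refine Or.inl ?_
    simp only [Complex.sub_re, Complex.one_re, Complex.ofReal_re]
    linarith
  set x := s / (m * r ^ α)
  rw [eta, gauss2F1_eq (isGaussContinuation_gaussIntegral m hδ0 hδ) hz, gaussIntegral]
  have : ∫ t in Ioc (0 : ℝ) 1, ((t ^ (-(2 / α) - 1) : ℝ) : ℂ) * gaussKernel m ((-x : ℝ) : ℂ) t =
      ((∫ t in Ioc (0 : ℝ) 1, t ^ (-(2 / α) - 1) * (1 - (1 + x * t) ^ (-m)) : ℝ) : ℂ) := by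
    rw [← integral_complex_ofReal]
    refine setIntegral_congr_fun measurableSet_Ioc fun t ht => ?_
    have h1 : 0 ≤ 1 + x * t := by have := mul_nonneg hx ht.1.le; linarith
    rw [gaussKernel, Complex.ofReal_mul, Complex.ofReal_sub, Complex.ofReal_cpow h1]
    push_cast
    ring_nf
  rw [this, ← Complex.ofReal_mul, ← Complex.ofReal_one, ← Complex.ofReal_add, Complex.ofReal_re]

/-! ### Polar coordinates and the exponent outside a disc -/

lemma integral_plane_norm (G : ℝ → ℝ) :
    ∫ y : Plane, G ‖y‖ = 2 * Real.pi * ∫ ρ in Ioi (0 : ℝ), ρ * G ρ := by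
  rw [integral_fun_norm_addHaar volume G, measureReal_def, EuclideanSpace.volume_ball_fin_two]
  simp [mul_assoc, Real.pi_pos.le]

/-- Polar coordinates followed by the substitution `ρ = r t^{-1/α}`. -/
lemma integral_plane_eq_integral_Ioc {α r : ℝ} (hα : 0 < α) (hr : 0 < r) (k : ℝ → ℝ) :
    ∫ y : Plane, (if r < ‖y‖ then k (‖y‖ ^ (-α)) else 0) =
      Real.pi * r ^ 2 * (2 / α * ∫ t in Ioc (0 : ℝ) 1, t ^ (-(2 / α) - 1) * k (t * r ^ (-α))) := by
  rw [integral_plane_norm fun ρ => if r < ρ then k (ρ ^ (-α)) else 0]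
  set G : ℝ → ℝ := fun ρ => ρ * if r < ρ then k (ρ ^ (-α)) else 0 with hG
  -- The substitution is done in two moves, `ρ = r u` and then `u = t^{-1/α}`; the region `ρ > r`
  -- becomes `t < 1`.
  have h1 := integral_comp_mul_left_Ioi G 0 hr
  rw [mul_zero, ← integral_comp_rpow_Ioi (fun u => G (r * u)) (p := -(1 / α))
    (neg_ne_zero.2 (by positivity)), smul_eq_mul, eq_inv_mul_iff_mul_eq₀ hr.ne'] at h1
  rw [← h1, ← setIntegral_congr_set Ioo_ae_eq_Ioc, ← Ioi_inter_Iio,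
    ← setIntegral_indicator measurableSet_Iio]
  have h2 : ∀ t ∈ Ioi (0 : ℝ), (|-(1 / α)| * t ^ (-(1 / α) - 1)) • G (r * t ^ (-(1 / α))) =
      r / α * (Iio 1).indicator (fun t => t ^ (-(2 / α) - 1) * k (t * r ^ (-α))) t := fun t ht => by
    have ht : 0 < t := ht
    have h3 : (r < r * t ^ (-(1 / α))) ↔ t < 1 := by
      rw [lt_mul_iff_one_lt_right hr, Real.one_lt_rpow_iff_of_pos ht]
      have : 0 < 1 / α := by positivity
      constructor
      · rintro (h | h)
        · linarith [h.2]
        · exact h.1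
      · exact fun h => Or.inr ⟨h, by linarith⟩
    have h4 : (r * t ^ (-(1 / α))) ^ (-α) = t * r ^ (-α) := by
      rw [Real.mul_rpow hr.le (by positivity), ← Real.rpow_mul ht.le,
        show -(1 / α) * -α = 1 by field_simp, Real.rpow_one, mul_comm]
    simp only [hG, h3, h4, smul_eq_mul, abs_neg]
    rw [abs_of_pos (by positivity)]
    by_cases h : t < 1
    · rw [if_pos h, indicator_of_mem (mem_Iio.2 h),
        show -(2 / α) - 1 = (-(1 / α) - 1) + -(1 / α) by ring, Real.rpow_add ht]
      ring
    · rw [if_neg h, indicator_of_notMem (by simpa using h)]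
      simp
  rw [setIntegral_congr_fun measurableSet_Ioi h2, integral_const_mul]
  ring

lemma one_sub_expNeg_gammaLogLaplace {m v : ℝ} (hm : 0 < m) (hv : 0 ≤ v) :
    1 - expNeg (gammaLogLaplace m (ENNReal.ofReal v)) =
      ENNReal.ofReal (1 - (1 + v / m) ^ (-m)) := by
  rw [expNeg_gammaLogLaplace hm, ENNReal.toReal_ofReal hv, ENNReal.ofReal_sub _ (by positivity),
    ENNReal.ofReal_one]

lemma one_sub_rpow_neg_nonneg {m v : ℝ} (hm : 0 < m) (hv : 0 ≤ v) :
    0 ≤ 1 - (1 + v) ^ (-m) :=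
  sub_nonneg.2 (Real.rpow_le_one_of_one_le_of_nonpos (by linarith) (by linarith))

lemma one_le_eta {α s m r : ℝ} (hα : 2 < α) (hm : 0 < m) (hx : 0 ≤ s / (m * r ^ α)) :
    1 ≤ eta α s m r := by
  rw [eta_eq hα hx]
  have : 0 ≤ ∫ t in Ioc (0 : ℝ) 1, t ^ (-(2 / α) - 1) * (1 - (1 + s / (m * r ^ α) * t) ^ (-m)) :=
    setIntegral_nonneg measurableSet_Ioc fun t ht => mul_nonneg (Real.rpow_nonneg ht.1.le _)
      (one_sub_rpow_neg_nonneg hm (mul_nonneg hx ht.1.le))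
  have : 0 < α := by linarith
  have : 0 < 2 / α := by positivity
  nlinarith

lemma zetaFun_pos {α m : ℝ} (hα : 2 < α) (hm : 0 < m) : 0 < zetaFun α m := by
  have hδ : 2 / α < 1 := (div_lt_one (by linarith)).2 hα
  have hα0 : 0 < α := by linarith
  have h := two_mul_zetaFun (m := m) hα
  have h1 := Real.Gamma_pos_of_pos hm
  have h2 := Real.Gamma_pos_of_pos (show 0 < 1 - 2 / α by linarith)
  have h3 := Real.Gamma_pos_of_pos (show 0 < m + 2 / α by positivity)
  have : 0 < 2 * zetaFun α m := by rw [h]; positivity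
  linarith

lemma lintegral_one_sub_expNeg_gammaLogLaplace_beyond {α m s r : ℝ} (hα : 2 < α) (hm : 0 < m)
    (hs : 0 ≤ s) (hr : 0 < r) :
    ∫⁻ y : Plane, (if r < ‖y‖ then
        1 - expNeg (gammaLogLaplace m (ENNReal.ofReal (s * ‖y‖ ^ (-α)))) else 0) =
      ENNReal.ofReal (Real.pi * r ^ 2 * (eta α s m r - 1)) := by
  have hα0 : 0 < α := by linarith
  set k : ℝ → ℝ := fun v => 1 - (1 + s * v / m) ^ (-m) with hk
  have hkm : Measurable k := by fun_prop
  have hGm : Measurable fun y : Plane => if r < ‖y‖ then k (‖y‖ ^ (-α)) else 0 :=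
    Measurable.ite (measurableSet_lt measurable_const measurable_norm) (by fun_prop)
      measurable_const
  have hk0 : ∀ y : Plane, 0 ≤ k (‖y‖ ^ (-α)) := fun y => by
    have : 0 ≤ s * ‖y‖ ^ (-α) / m := by positivity
    exact one_sub_rpow_neg_nonneg hm this
  have h1 : ∀ y : Plane, (if r < ‖y‖ then
        1 - expNeg (gammaLogLaplace m (ENNReal.ofReal (s * ‖y‖ ^ (-α)))) else 0) =
      ENNReal.ofReal (if r < ‖y‖ then k (‖y‖ ^ (-α)) else 0) := fun y => by
    split_ifs
    · rw [one_sub_expNeg_gammaLogLaplace hm (by positivity)]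
    · simp
  -- Finiteness follows by comparison with the integral over the whole plane.
  have hfin : ∫⁻ y : Plane, ENNReal.ofReal (if r < ‖y‖ then k (‖y‖ ^ (-α)) else 0) ≠ ∞ := by
    refine ((lintegral_mono fun y => ?_).trans_lt
      ((lintegral_one_sub_expNeg_gammaLogLaplace hα hm hs).trans_lt ENNReal.ofReal_lt_top)).ne
    rw [← h1]
    dsimp only
    split_ifs
    · exact le_rfl
    · exact zero_le
  have h0 : ∀ y : Plane, 0 ≤ if r < ‖y‖ then k (‖y‖ ^ (-α)) else 0 := fun y => by
    split_ifs
    · exact hk0 y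
    · exact le_rfl
  have hint : Integrable fun y : Plane => if r < ‖y‖ then k (‖y‖ ^ (-α)) else 0 :=
    ⟨hGm.aestronglyMeasurable, (hasFiniteIntegral_iff_ofReal (Filter.Eventually.of_forall h0)).2
      hfin.lt_top⟩
  simp_rw [h1]
  rw [← ofReal_integral_eq_lintegral_ofReal hint (Filter.Eventually.of_forall h0),
    integral_plane_eq_integral_Ioc hα0 hr, eta_eq hα (by positivity), add_sub_cancel_left]
  congr 3
  refine setIntegral_congr_fun (measurableSet_Ioc (a := (0 : ℝ)) (b := 1)) fun t _ => ?_
  simp only [hk]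
  rw [Real.rpow_neg hr.le]
  have : 0 < r ^ α := by positivity
  congr 4
  field_simp

lemma lintegral_exp_neg_mul_sq_norm {b : ℝ} (hb : 0 < b) :
    ∫⁻ x : Plane, ENNReal.ofReal (Real.exp (-(b * ‖x‖ ^ 2))) = ENNReal.ofReal (Real.pi / b) := by
  have h := GaussianFourier.integral_rexp_neg_mul_sq_norm (V := Plane) hb
  simp only [finrank_euclideanSpace_fin, Nat.cast_ofNat, div_self (two_ne_zero (α := ℝ)),
    Real.rpow_one, neg_mul] at h
  rw [← h, ofReal_integral_eq_lintegral_ofReal _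
    (Filter.Eventually.of_forall fun _ => Real.exp_nonneg _)]
  by_contra hi
  rw [integral_undef hi] at h
  have : 0 < Real.pi / b := by positivity
  exact this.ne h

lemma integral_mul_exp_neg_mul_sq_Ioi {b : ℝ} (hb : 0 < b) :
    ∫ r in Ioi (0 : ℝ), r * Real.exp (-(b * r ^ 2)) = 1 / (2 * b) := by
  have h := integral_plane_norm fun ρ => Real.exp (-(b * ρ ^ 2))
  have h2 := GaussianFourier.integral_rexp_neg_mul_sq_norm (V := Plane) hb
  simp only [finrank_euclideanSpace_fin, Nat.cast_ofNat, div_self (two_ne_zero (α := ℝ)),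
    Real.rpow_one, neg_mul] at h2
  rw [h2] at h
  have := Real.pi_pos
  field_simp at h ⊢
  linarith

lemma pathloss_zero {α r : ℝ} (hr : 0 ≤ r) : pathloss α 0 r = r ^ (-α) := by
  rw [pathloss, zero_pow two_ne_zero, add_zero, ← Real.rpow_natCast, ← Real.rpow_mul hr]
  congr 1
  push_cast
  ring

lemma gammaLogLaplace_zero (m : ℝ) : gammaLogLaplace m 0 = 0 := by simp [gammaLogLaplace]

lemma gammaLogLaplace_ne_top (m : ℝ) (c : ℝ≥0∞) : gammaLogLaplace m c ≠ ∞ := ENNReal.ofReal_ne_top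

lemma gammaLogLaplace_ofReal_mono {m : ℝ} (hm : 0 < m) :
    Monotone fun v => gammaLogLaplace m (ENNReal.ofReal v) := fun v w h => by
  refine ENNReal.ofReal_le_ofReal (mul_le_mul_of_nonneg_left (Real.log_le_log ?_ ?_) hm.le)
  · have : 0 ≤ (ENNReal.ofReal v).toReal / m := by positivity
    linarith
  · gcongr
    exact ENNReal.ofReal_ne_top

lemma continuous_gammaLogLaplace_ofReal {m : ℝ} (hm : 0 < m) :
    Continuous fun v => gammaLogLaplace m (ENNReal.ofReal v) := by
  have h : Continuous fun v : ℝ => ENNReal.ofReal (m * Real.log (1 + max v 0 / m)) := by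
    refine ENNReal.continuous_ofReal.comp (continuous_const.mul (Continuous.log (by fun_prop) ?_))
    intro v
    have : 0 ≤ max v 0 / m := by positivity
    linarith
  simpa only [gammaLogLaplace, ENNReal.toReal_ofReal'] using h

/-! ### Void probabilities and Laplace transforms seen from a generic server -/

/-- The mean measure exponent at a server at distance `r`: no point in the exclusion disc, and
interference scaled by `K`. -/
noncomputable def Association.exponent (a : Association) (α m K r : ℝ) : ℝ≥0∞ :=
  ∫⁻ y : Plane, (1 - expNeg ((if ‖y‖ < a.exclusion r then ∞ else 0) +
    gammaLogLaplace m (ENNReal.ofReal (K * ‖y‖ ^ (-α)))))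

lemma Association.measurable_exclusion (a : Association) : Measurable a.exclusion := by
  cases a
  · exact measurable_id
  · exact measurable_const

lemma eta_zero {α m r : ℝ} (hα : 2 < α) : eta α 0 m r = 1 := by
  rw [eta_eq hα (by simp)]
  simp

lemma exponent_closest {α m K r : ℝ} (hα : 2 < α) (hm : 0 < m) (hK : 0 ≤ K) (hr : 0 < r) :
    Association.closest.exponent α m K r = ENNReal.ofReal (Real.pi * r ^ 2 * eta α K m r) := by
  have hη := one_le_eta (s := K) (r := r) hα hm (by positivity)
  -- Inside the disc the integrand is `1` and contributes the area `π r²`, which turns `η - 1` into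
  -- `η`; the boundary circle is null.
  have h1 : (fun y : Plane => 1 - expNeg ((if ‖y‖ < r then ∞ else 0) +
      gammaLogLaplace m (ENNReal.ofReal (K * ‖y‖ ^ (-α))))) =ᵐ[volume]
      fun y => (Metric.ball 0 r).indicator 1 y + if r < ‖y‖ then
        1 - expNeg (gammaLogLaplace m (ENNReal.ofReal (K * ‖y‖ ^ (-α)))) else 0 := by
    have h0 : volume (Metric.sphere (0 : Plane) r) = 0 := Measure.addHaar_sphere _ _ _
    filter_upwards [compl_mem_ae_iff.2 h0] with y hy
    have hy : ‖y‖ ≠ r := by simpa using hy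
    rcases hy.lt_or_gt with h | h
    · simp [h, h.not_gt, expNeg_top]
    · simp [h, h.not_gt]
  rw [Association.exponent, Association.exclusion, lintegral_congr_ae h1,
    lintegral_add_left (measurable_one.indicator measurableSet_ball),
    lintegral_indicator_one measurableSet_ball, EuclideanSpace.volume_ball_fin_two,
    lintegral_one_sub_expNeg_gammaLogLaplace_beyond hα hm hK hr, ← ENNReal.ofReal_pow hr.le,
    ← ENNReal.ofReal_mul (by positivity), ← ENNReal.ofReal_add (by positivity)
    (mul_nonneg (by positivity) (by linarith))]
  congr 1
  ring

lemma exponent_strongest {α m K r : ℝ} (hα : 2 < α) (hm : 0 < m) (hK : 0 ≤ K) :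
    Association.strongest.exponent α m K r =
      ENNReal.ofReal (Real.pi * (2 * zetaFun α m) * (K / m) ^ (2 / α)) := by
  rw [← lintegral_one_sub_expNeg_gammaLogLaplace hα hm hK, Association.exponent]
  simp [Association.exclusion, not_lt.2]

/-! ### Received powers, their measurability and unconditional Laplace transforms -/

lemma rxPower_pathloss {Ω : Type*} {α : ℝ} {X : ℕ → Ω → Plane} {g : ℕ → Ω → ℝ} (i : ℕ)
    (ω : Ω) : rxPower (pathloss α 0) X g i ω =
    ENNReal.ofReal (g i ω) * ENNReal.ofReal (‖X i ω‖ ^ (-α)) := by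
  rw [rxPower, pathloss_zero (norm_nonneg _), ENNReal.ofReal_mul' (by positivity)]

lemma interference_le_tsum {Ω : Type*} {X : ℕ → Ω → Plane} {g : ℕ → Ω → ℝ} (l : ℝ → ℝ)
    (i : ℕ) (ω : Ω) :
    interference l X g i ω ≤ ∑' j, rxPower l X g j ω := by
  refine ENNReal.tsum_le_tsum fun j => ?_
  split_ifs
  · exact zero_le
  · exact le_rfl

/-- A station at the origin is excluded on the left and contributes `0 ^ (-α) = 0` on the right. -/
lemma interferenceBeyond_zero {Ω : Type*} {α : ℝ} {X : ℕ → Ω → Plane} {g : ℕ → Ω → ℝ}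
    (ω : Ω) (hα : 0 < α) :
    interferenceBeyond (pathloss α 0) X g 0 ω = ∑' j, rxPower (pathloss α 0) X g j ω := by
  refine tsum_congr fun j => ?_
  split_ifs with hj
  · rfl
  · have : X j ω = 0 := by simpa using hj
    simp [rxPower_pathloss, this, Real.zero_rpow (neg_ne_zero.2 hα.ne')]

section PPP

variable {Ω : Type*} [MeasurableSpace Ω] {P : Measure Ω} {lam α m : ℝ} {ν : Measure ℝ}
    {X : ℕ → Ω → Plane} {g : ℕ → Ω → ℝ}

lemma IsMarkedPPP.measurable_rxPower (h : IsMarkedPPP P lam ν X g) (i : ℕ) :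
    Measurable (rxPower (pathloss α 0) X g i) := by
  have h1 := h.measurable_loc i
  have h2 := h.measurable_mark i
  have : rxPower (pathloss α 0) X g i = fun ω =>
    ENNReal.ofReal (g i ω) * ENNReal.ofReal (‖X i ω‖ ^ (-α)) := funext (rxPower_pathloss i)
  rw [this]
  fun_prop

lemma IsMarkedPPP.measurable_interference (h : IsMarkedPPP P lam ν X g) (i : ℕ) :
    Measurable (interference (pathloss α 0) X g i) := by
  refine Measurable.tsum fun j => ?_
  split_ifs
  · exact measurable_const
  · exact h.measurable_rxPower j

lemma IsMarkedPPP.measurable_interferenceBeyond (h : IsMarkedPPP P lam ν X g) (ρ : ℝ) :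
    Measurable (interferenceBeyond (pathloss α 0) X g ρ) :=
  Measurable.tsum fun j => Measurable.ite (measurableSet_lt measurable_const (h.measurable_loc j).norm)
    (h.measurable_rxPower j) measurable_const

lemma IsMarkedPPP.lintegral_expNeg_interferenceBeyond [IsProbabilityMeasure P] (hm : 0 < m)
    (h : IsMarkedPPP P lam (gammaMeasure m m) X g) {s : ℝ} (hs : 0 ≤ s) (ρ : ℝ) :
    ∫⁻ ω, expNeg (ENNReal.ofReal s * interferenceBeyond (pathloss α 0) X g ρ ω) ∂P =
      expNeg (ENNReal.ofReal lam * ∫⁻ y : Plane, (if ρ < ‖y‖ then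
        1 - expNeg (gammaLogLaplace m (ENNReal.ofReal (s * ‖y‖ ^ (-α)))) else 0)) := by
  have hS : MeasurableSet {y : Plane | ρ < ‖y‖} := measurableSet_lt measurable_const measurable_norm
  have hψ := measurable_gammaLogLaplace m
  let c : Plane → ℝ≥0∞ := fun y => if ρ < ‖y‖ then ENNReal.ofReal (s * ‖y‖ ^ (-α)) else 0
  have hc : Measurable c := Measurable.ite hS (by fun_prop) measurable_const
  have h1 : ∀ ω, ENNReal.ofReal s * interferenceBeyond (pathloss α 0) X g ρ ω =
      ∑' j, ENNReal.ofReal (g j ω) * c (X j ω) := fun ω => by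
    rw [interferenceBeyond, ← ENNReal.tsum_mul_left]
    refine tsum_congr fun j => ?_
    simp only [c]
    split_ifs
    · rw [rxPower_pathloss, ENNReal.ofReal_mul hs]
      ring
    · simp
  simp_rw [h1]
  have h2 := h.lintegral_mul_expNeg_marks (isLogLaplace_gamma hm) (w := fun _ => 1)
    (c := fun x j => c (x j)) measurable_const (fun j => hc.comp (measurable_pi_apply j))
    fun x j => by
      dsimp only [c]
      split_ifs
      · exact ENNReal.ofReal_ne_top
      · exact ENNReal.zero_ne_top
  simp only [one_mul] at h2
  rw [h2, h.laplace_functional (f := fun y => gammaLogLaplace m (c y)) (by fun_prop)]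
  congr 3 with y
  simp only [c]
  split_ifs
  · rfl
  · simp [gammaLogLaplace_zero, expNeg_zero]

/-- For `s > 0`, `e^{-sT}` vanishes where the total power `T` is infinite, so `E[e^{-sT}] ≤ P(T <
∞)`; the left side tends to `1` as `s → 0`. -/
theorem IsMarkedPPP.ae_tsum_rxPower_ne_top [IsProbabilityMeasure P] (hα : 2 < α) (hlam : 0 < lam)
    (hm : 0 < m) (h : IsMarkedPPP P lam (gammaMeasure m m) X g) :
    ∀ᵐ ω ∂P, ∑' j, rxPower (pathloss α 0) X g j ω ≠ ∞ := by
  have hα0 : 0 < α := by linarith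
  set T : Ω → ℝ≥0∞ := fun ω => ∑' j, rxPower (pathloss α 0) X g j ω
  have hT : Measurable T := Measurable.tsum fun j => h.measurable_rxPower j
  have hS : MeasurableSet {ω | T ω ≠ ∞} := hT (measurableSet_singleton ∞).compl
  let A : ℝ → ℝ := fun s => lam * (Real.pi * (2 * zetaFun α m) * (s / m) ^ (2 / α))
  have hA : Filter.Tendsto (fun s : ℝ => ENNReal.ofReal (Real.exp (-(A s)))) (nhdsWithin 0 (Ioi 0))
      (nhds 1) := by
    have h1 : Continuous A := by
      have : Continuous fun s : ℝ => (s / m) ^ (2 / α) :=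
        (Real.continuous_rpow_const (by positivity)).comp (continuous_id.div_const _)
      fun_prop
    have h2 : Continuous fun s : ℝ => ENNReal.ofReal (Real.exp (-(A s))) :=
      ENNReal.continuous_ofReal.comp (Real.continuous_exp.comp h1.neg)
    have h3 := (h2.tendsto 0).mono_left (nhdsWithin_le_nhds (s := Ioi 0))
    have h4 : A 0 = 0 := by simp [A, Real.zero_rpow (show 2 / α ≠ 0 by positivity)]
    simpa [h4] using h3
  have hle : ∀ s ∈ Ioi (0 : ℝ), ENNReal.ofReal (Real.exp (-(A s))) ≤ P {ω | T ω ≠ ∞} := by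
    intro s hs
    have hs : 0 < s := hs
    have hζ := zetaFun_pos hα hm
    have h1 := h.lintegral_expNeg_interferenceBeyond (α := α) hm hs.le 0
    have h2 : ∀ y : Plane, (if 0 < ‖y‖ then
        1 - expNeg (gammaLogLaplace m (ENNReal.ofReal (s * ‖y‖ ^ (-α)))) else 0) =
        1 - expNeg (gammaLogLaplace m (ENNReal.ofReal (s * ‖y‖ ^ (-α)))) := fun y => by
      split_ifs with hy
      · rfl
      · have : y = 0 := by simpa using hy
        simp [this, Real.zero_rpow (neg_ne_zero.2 hα0.ne'), gammaLogLaplace_zero, expNeg_zero]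
    simp_rw [h2, interferenceBeyond_zero _ hα0] at h1
    rw [lintegral_one_sub_expNeg_gammaLogLaplace hα hm hs.le, ← ENNReal.ofReal_mul hlam.le,
      expNeg_ofReal (by positivity)] at h1
    rw [← h1, ← lintegral_indicator_one hS]
    refine lintegral_mono fun ω => ?_
    by_cases hω : T ω = ∞
    · have : ENNReal.ofReal s * ∞ = ∞ := ENNReal.mul_top (by simpa using hs)
      change expNeg (ENNReal.ofReal s * T ω) ≤ _
      rw [hω, this, expNeg_top]
      exact zero_le
    · rw [indicator_of_mem (show ω ∈ {ω | T ω ≠ ∞} from hω)]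
      exact expNeg_le_one _
  have h1 : 1 ≤ P {ω | T ω ≠ ∞} := le_of_tendsto hA (by
    filter_upwards [self_mem_nhdsWithin] with s hs using hle s hs)
  exact (prob_compl_eq_zero_iff hS).2 (le_antisymm prob_le_one h1)

lemma ofReal_exp_neg_mul_toReal {s : ℝ} (hs : 0 ≤ s) {I : ℝ≥0∞} (hI : I ≠ ∞) :
    ENNReal.ofReal (Real.exp (-(s * I.toReal))) = expNeg (ENNReal.ofReal s * I) := by
  conv_rhs => rw [← ENNReal.ofReal_toReal hI]
  rw [← ENNReal.ofReal_mul hs, expNeg_ofReal (by positivity)]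

/-- Almost sure finiteness is essential: `toReal` sends `∞` to `0`, so the two exponentials would
otherwise disagree. -/
lemma laplace_eq_toReal_lintegral {I : Ω → ℝ≥0∞} (hI : Measurable I) (hfin : ∀ᵐ ω ∂P, I ω ≠ ∞)
    {s : ℝ} (hs : 0 ≤ s) :
    laplace P I s = (∫⁻ ω, expNeg (ENNReal.ofReal s * I ω) ∂P).toReal := by
  rw [laplace, integral_eq_lintegral_of_nonneg_ae
    (Filter.Eventually.of_forall fun _ => Real.exp_nonneg _)
    (Measurable.aestronglyMeasurable (by fun_prop))]
  congr 1
  refine lintegral_congr_ae ?_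
  filter_upwards [hfin] with ω hω using ofReal_exp_neg_mul_toReal hs hω

lemma IsMarkedPPP.laplace_interferenceBeyond [IsProbabilityMeasure P] (hα : 2 < α) (hlam : 0 < lam)
    (hm : 0 < m) (h : IsMarkedPPP P lam (gammaMeasure m m) X g) {s : ℝ} (hs : 0 ≤ s) (ρ : ℝ)
    {E : ℝ} (hE0 : 0 ≤ E) (hE : ∫⁻ y : Plane, (if ρ < ‖y‖ then
        1 - expNeg (gammaLogLaplace m (ENNReal.ofReal (s * ‖y‖ ^ (-α)))) else 0) =
          ENNReal.ofReal E) :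
    laplace P (interferenceBeyond (pathloss α 0) X g ρ) s = Real.exp (-(lam * E)) := by
  rw [laplace_eq_toReal_lintegral (h.measurable_interferenceBeyond ρ) _ hs,
    h.lintegral_expNeg_interferenceBeyond hm hs, hE, ← ENNReal.ofReal_mul hlam.le,
    expNeg_ofReal (by positivity), ENNReal.toReal_ofReal (Real.exp_nonneg _)]
  filter_upwards [h.ae_tsum_rxPower_ne_top hα hlam hm] with ω hω
  refine ne_top_of_le_ne_top hω (ENNReal.tsum_le_tsum fun j => ?_)
  split_ifs
  · exact le_rfl
  · exact zero_le

theorem IsMarkedPPP.laplaceInterference_closest [IsProbabilityMeasure P] (hα : 2 < α)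
    (hlam : 0 < lam) (hm : 0 < m) (h : IsMarkedPPP P lam (gammaMeasure m m) X g) {s r : ℝ}
    (hs : 0 ≤ s) (hr : 0 < r) :
    Association.closest.laplaceInterference P (pathloss α 0) X g r s =
      Real.exp (-(Real.pi * lam * r ^ 2 * (eta α s m r - 1))) := by
  have hη := one_le_eta (s := s) (r := r) hα hm (by positivity)
  rw [Association.laplaceInterference, Association.exclusion, h.laplace_interferenceBeyond hα hlam hm
    hs r (mul_nonneg (by positivity) (by linarith))
    (lintegral_one_sub_expNeg_gammaLogLaplace_beyond hα hm hs hr)]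
  congr 1
  ring

theorem IsMarkedPPP.laplaceInterference_strongest [IsProbabilityMeasure P] (hα : 2 < α)
    (hlam : 0 < lam) (hm : 0 < m) (h : IsMarkedPPP P lam (gammaMeasure m m) X g) {s : ℝ} (r : ℝ)
    (hs : 0 ≤ s) :
    Association.strongest.laplaceInterference P (pathloss α 0) X g r s =
      Real.exp (-(2 * Real.pi * lam * zetaFun α m * (s / m) ^ (2 / α))) := by
  have hζ := zetaFun_pos hα hm
  have hα0 : 0 < α := by linarith
  rw [Association.laplaceInterference, Association.exclusion, h.laplace_interferenceBeyond hα hlam hm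
    hs 0 (E := Real.pi * (2 * zetaFun α m) * (s / m) ^ (2 / α)) (by positivity)]
  · congr 1
    ring
  · rw [← lintegral_one_sub_expNeg_gammaLogLaplace hα hm hs]
    congr 1 with y
    split_ifs with hy
    · rfl
    · have : y = 0 := by simpa using hy
      simp [this, Real.zero_rpow (neg_ne_zero.2 hα0.ne'), gammaLogLaplace_zero, expNeg_zero]

end PPP

/-! ### Sums over candidate servers with the marks averaged out -/

section PPP

variable {Ω : Type*} [MeasurableSpace Ω] {P : Measure Ω} {lam α m : ℝ} {ν : Measure ℝ}
    {X : ℕ → Ω → Plane} {g : ℕ → Ω → ℝ}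

lemma IsMarkedPPP.lintegral_tsum_mul_expNeg_marks [IsProbabilityMeasure P]
    (h : IsMarkedPPP P lam ν X g) {ψ : ℝ≥0∞ → ℝ≥0∞} (hψ : IsLogLaplace ν ψ) (hψ0 : ψ 0 = 0)
    {w : ℕ → (ℕ → Plane) → ℝ≥0∞} {c : Plane → Plane → ℝ≥0∞} (hw : ∀ i, Measurable (w i))
    (hcm : Measurable (Function.uncurry c)) (hc : ∀ x y, c x y ≠ ∞) :
    ∫⁻ ω, ∑' i, w i (fun k => X k ω) * expNeg (∑' j, if j = i then 0 else
        ENNReal.ofReal (g j ω) * c (X i ω) (X j ω)) ∂P =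
      ∫⁻ ω, ∑' i, w i (fun k => X k ω) *
        expNeg (∑' j, if j = i then 0 else ψ (c (X i ω) (X j ω))) ∂P := by
  have hg := h.measurable_mark
  have hX := h.measurable_loc
  have hψm := hψ.1
  have hXm : Measurable fun ω k => X k ω := measurable_pi_lambda _ hX
  have hcX : ∀ i j, Measurable fun ω => c (X i ω) (X j ω) := fun i j =>
    hcm.comp ((hX i).prodMk (hX j))
  have hwX : ∀ i, Measurable fun ω => w i (fun k => X k ω) := fun i => (hw i).comp hXm
  rw [lintegral_tsum fun i => ((hwX i).fun_mul (Measurable.expNeg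
      (Measurable.tsum fun j => ?_))).aemeasurable,
    lintegral_tsum fun i => ((hwX i).fun_mul (Measurable.expNeg
      (Measurable.tsum fun j => ?_))).aemeasurable]
  · refine tsum_congr fun i => ?_
    have := h.lintegral_mul_expNeg_marks hψ (w := w i)
      (c := fun x j => if j = i then 0 else c (x i) (x j)) (hw i) (fun j => by
        split_ifs
        · exact measurable_const
        · exact hcm.comp (show Measurable fun x : ℕ → Plane => (x i, x j) by fun_prop)) (fun x j => by
        split_ifs
        · exact ENNReal.zero_ne_top
        · exact hc _ _)
    simpa only [mul_ite, mul_zero, apply_ite ψ, hψ0] using this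
  · split_ifs
    · exact measurable_const
    · have := hcX i j
      fun_prop
  · split_ifs
    · exact measurable_const
    · have := hcX i j
      fun_prop

/-- With the locations fixed, the exponential tail of `g i` makes the coverage indicator average to
the same exponential as a Laplace transform; coverage and Laplace computations therefore share one
formula. -/
lemma IsMarkedPPP.lintegral_tsum_mul_indicator_marks [IsProbabilityMeasure P]
    (h : IsMarkedPPP P lam (expMeasure 1) X g) {ψ : ℝ≥0∞ → ℝ≥0∞}
    (hψ : IsLogLaplace (expMeasure 1) ψ) (hψ0 : ψ 0 = 0)
    {w : ℕ → (ℕ → Plane) → ℝ≥0∞} {c : Plane → Plane → ℝ≥0∞} (hw : ∀ i, Measurable (w i))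
    (hcm : Measurable (Function.uncurry c)) (hc : ∀ x y, c x y ≠ ∞) :
    ∫⁻ ω, ∑' i, w i (fun k => X k ω) * (if (∑' j, if j = i then 0 else
        ENNReal.ofReal (g j ω) * c (X i ω) (X j ω)) < ENNReal.ofReal (g i ω) then 1 else 0) ∂P =
      ∫⁻ ω, ∑' i, w i (fun k => X k ω) *
        expNeg (∑' j, if j = i then 0 else ψ (c (X i ω) (X j ω))) ∂P := by
  have hg := h.measurable_mark
  have hX := h.measurable_loc
  have hψm := hψ.1
  have hXm : Measurable fun ω k => X k ω := measurable_pi_lambda _ hX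
  let C : ℕ → (ℕ → Plane) → ℕ → ℝ≥0∞ := fun i x j => if j = i then 0 else c (x i) (x j)
  have hCm : ∀ i j, Measurable fun x => C i x j := fun i j => by
    dsimp only [C]
    split_ifs
    · exact measurable_const
    · exact hcm.comp (show Measurable fun x : ℕ → Plane => (x i, x j) by fun_prop)
  have hCt : ∀ i x j, C i x j ≠ ∞ := fun i x j => by
    dsimp only [C]
    split_ifs
    · exact ENNReal.zero_ne_top
    · exact hc _ _
  let F : ℕ → (ℕ → Plane) → (ℕ → ℝ) → ℝ≥0∞ := fun i x t => w i x *
    if ∑' j, ENNReal.ofReal (t j) * C i x j < ENNReal.ofReal (t i) then 1 else 0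
  have hF : ∀ i, Measurable (Function.uncurry (F i)) := fun i => by
    refine ((hw i).comp measurable_fst).fun_mul (Measurable.ite (measurableSet_lt
      (Measurable.tsum fun j => ?_) ?_) measurable_const measurable_const)
    · exact (ENNReal.measurable_ofReal.comp
        ((measurable_pi_apply j).comp measurable_snd)).fun_mul ((hCm i j).comp measurable_fst)
    · exact ENNReal.measurable_ofReal.comp ((measurable_pi_apply i).comp measurable_snd)
  have hFX : ∀ i, Measurable fun ω => F i (fun k => X k ω) fun k => g k ω := fun i =>
    (hF i).comp (hXm.prodMk (measurable_pi_lambda _ hg))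
  have hL : ∀ ω, (∑' i, w i (fun k => X k ω) * (if (∑' j, if j = i then 0 else
        ENNReal.ofReal (g j ω) * c (X i ω) (X j ω)) < ENNReal.ofReal (g i ω) then 1 else 0)) =
      ∑' i, F i (fun k => X k ω) fun k => g k ω := fun ω => by
    simp only [F, C, mul_ite, mul_zero]
  have hR : ∀ ω, (∑' i, w i (fun k => X k ω) *
        expNeg (∑' j, if j = i then 0 else ψ (c (X i ω) (X j ω)))) =
      ∑' i, w i (fun k => X k ω) * expNeg (∑' j, ψ (C i (fun k => X k ω) j)) := fun ω => by
    simp only [C, apply_ite ψ, hψ0]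
  simp_rw [hL, hR]
  have hRX : ∀ i, Measurable fun ω => w i (fun k => X k ω) *
      expNeg (∑' j, ψ (C i (fun k => X k ω) j)) := fun i =>
    ((hw i).comp hXm).fun_mul (Measurable.expNeg (Measurable.tsum fun j =>
      hψm.comp ((hCm i j).comp hXm)))
  rw [lintegral_tsum fun i => (hFX i).aemeasurable, lintegral_tsum fun i => (hRX i).aemeasurable]
  refine tsum_congr fun i => ?_
  rw [h.lintegral_eq_lintegral_lintegral (hF i)]
  refine lintegral_congr fun ω => ?_
  have hS : MeasurableSet {ω' | ∑' j, ENNReal.ofReal (g j ω') * C i (fun k => X k ω) j <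
      ENNReal.ofReal (g i ω')} := measurableSet_lt (by fun_prop) (by fun_prop)
  rw [← h.measure_tsum_marks_lt hψ (c := C i fun k => X k ω) (hCt i fun k => X k ω) (i := i)
    (by simp [C]), ← lintegral_indicator_one hS,
    ← lintegral_const_mul _ (measurable_one.indicator hS)]
  simp only [F, indicator_apply, mem_ofPred_eq, Pi.one_apply]

/-- `1` if no point lies in the exclusion disc of the `i`-th point, `0` otherwise. -/
noncomputable def Association.eligible (a : Association) (i : ℕ) (x : ℕ → Plane) : ℝ≥0∞ :=
  expNeg (∑' j, if j = i then 0 else if ‖x j‖ < a.exclusion ‖x i‖ then ∞ else 0)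

lemma Association.measurable_eligible (a : Association) (i : ℕ) : Measurable (a.eligible i) := by
  refine Measurable.expNeg (Measurable.tsum fun j => ?_)
  split_ifs
  · exact measurable_const
  · exact Measurable.ite (measurableSet_lt (measurable_pi_apply j).norm
      (a.measurable_exclusion.comp (measurable_pi_apply i).norm)) measurable_const measurable_const

lemma Association.eligible_strongest (i : ℕ) (x : ℕ → Plane) :
    Association.strongest.eligible i x = 1 := by
  simp [eligible, Association.exclusion, not_lt.2, expNeg_zero]

open Classical in
lemma Association.eligible_closest (i : ℕ) (x : ℕ → Plane) :
    Association.closest.eligible i x = if ∀ j, ‖x i‖ ≤ ‖x j‖ then 1 else 0 := by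
  rw [eligible]
  split_ifs with hi
  · simp [Association.exclusion, (hi _).not_gt, expNeg_zero]
  · push Not at hi
    obtain ⟨j, hj⟩ := hi
    rw [expNeg_eq_zero]
    refine ENNReal.tsum_eq_top_of_eq_top ⟨j, ?_⟩
    have : j ≠ i := by rintro rfl; exact hj.false
    simp [this, Association.exclusion, hj]

/-- The mean number of eligible servers, weighted with the Laplace transform of a scaled
interference. -/
theorem IsMarkedPPP.lintegral_tsum_eligible_mul_expNeg [IsProbabilityMeasure P] (hm : 0 < m)
    (h : IsMarkedPPP P lam ν X g) (a : Association) {u : Plane → ℝ≥0∞} (hu : Measurable u)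
    (hu1 : ∀ y, u y ≤ 1) {κ : ℝ → ℝ} (hκ : Continuous κ) (hκm : MonotoneOn κ (Ici 0)) :
    ∫⁻ ω, ∑' i, u (X i ω) * a.eligible i (fun k => X k ω) * expNeg (∑' j, if j = i then 0 else
        gammaLogLaplace m (ENNReal.ofReal (κ ‖X i ω‖ * ‖X j ω‖ ^ (-α)))) ∂P =
      ENNReal.ofReal lam *
        ∫⁻ x, u x * expNeg (ENNReal.ofReal lam * a.exponent α m (κ ‖x‖) ‖x‖) := by
  have hψ := measurable_gammaLogLaplace m
  have hκ' := hκ.measurable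
  have hS : MeasurableSet {p : ℝ × Plane | ‖p.2‖ < a.exclusion p.1} :=
    measurableSet_lt measurable_snd.norm (a.measurable_exclusion.comp measurable_fst)
  have := h.lintegral_tsum_mul_expNeg_others_norm (w := u)
    (f := fun r y => (if ‖y‖ < a.exclusion r then ∞ else 0) +
      gammaLogLaplace m (ENNReal.ofReal (κ r * ‖y‖ ^ (-α)))) ?_ hu hu1 ?_ ?_ ?_
  · simp only [Association.exponent]
    rw [← this]
    refine lintegral_congr fun ω => tsum_congr fun i => ?_
    rw [mul_assoc, Association.eligible, ← expNeg_add, ← ENNReal.tsum_add]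
    congr 3 with j
    split_ifs <;> simp
  · exact (Measurable.ite hS measurable_const measurable_const).add (by fun_prop)
  · intro y r hr r' hr' hrr
    refine add_le_add ?_ (gammaLogLaplace_ofReal_mono hm
      (mul_le_mul_of_nonneg_right (hκm hr hr' hrr) (by positivity)))
    have : a.exclusion r ≤ a.exclusion r' := by
      cases a
      · exact hrr
      · exact le_rfl
    split_ifs with h1 h2
    · exact le_rfl
    · exact absurd (h1.trans_le this) h2
    · exact zero_le
    · exact le_rfl
  · intro y r hr
    refine ContinuousWithinAt.add ?_ (Continuous.continuousWithinAt
      ((continuous_gammaLogLaplace_ofReal hm).comp (hκ.mul_const _)))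
    cases a
    -- The strict inequality defining the disc gives left-continuity: for `‖y‖ < r` the value is `∞`
    -- near `r`, and for `r ≤ ‖y‖` it is `0` on all of `[0, r]`.
    · rcases lt_or_ge ‖y‖ r with hy | hy
      · refine ContinuousAt.continuousWithinAt (continuousAt_const.congr (f := fun _ => ∞) ?_)
        filter_upwards [lt_mem_nhds hy] with t ht
        exact (if_pos ht).symm
      · refine continuousWithinAt_const.congr (f := fun _ => 0) (fun t ht => ?_) ?_
        · exact if_neg (not_lt.2 (ht.2.trans hy))
        · exact if_neg (not_lt.2 hy)
    · exact continuousWithinAt_const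
  · intro y
    refine ENNReal.add_ne_top.2 ⟨?_, gammaLogLaplace_ne_top _ _⟩
    cases a <;> simp [Association.exclusion, not_lt.2]

end PPP

/-! ### The closest base station -/

open Classical in
lemma exists_forall_norm_le {x : ℕ → Plane}
    (hx : ∀ n : ℕ, ∑' i, (Metric.closedBall (0 : Plane) n).indicator (fun _ => (1 : ℝ≥0∞)) (x i) ≠ ∞) :
    ∃ i, ∀ j, ‖x i‖ ≤ ‖x j‖ := by
  obtain ⟨n, hn⟩ := exists_nat_ge ‖x 0‖
  have hfin : {i | ‖x i‖ ≤ n}.Finite := by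
    refine (ENNReal.finite_const_le_of_tsum_ne_top (hx n) one_ne_zero).subset fun i hi => ?_
    have : x i ∈ Metric.closedBall (0 : Plane) n := by simpa using hi
    simp only [mem_ofPred_eq, indicator_of_mem this, le_refl]
  obtain ⟨i, hi, hmin⟩ := hfin.toFinset.exists_min_image (fun i => ‖x i‖) ⟨0, by simpa using hn⟩
  refine ⟨i, fun j => ?_⟩
  by_cases hj : ‖x j‖ ≤ n
  · exact hmin j (by simpa using hj)
  · have : ‖x i‖ ≤ n := by simpa using hi
    exact this.trans (not_le.1 hj).le

section PPP

variable {Ω : Type*} [MeasurableSpace Ω] {P : Measure Ω} {lam α m : ℝ} {ν : Measure ℝ}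
    {X : ℕ → Ω → Plane} {g : ℕ → Ω → ℝ}

lemma IsMarkedPPP.ae_count_ne_top (h : IsMarkedPPP P lam ν X g) {A : Set Plane}
    (hA : MeasurableSet A) (hAf : volume A ≠ ∞) : ∀ᵐ ω ∂P, count X A ω ≠ ∞ := by
  have hm := measurable_count h.measurable_loc hA
  have hS : MeasurableSet {t : ℝ≥0∞ | t ≠ ∞} := (measurableSet_singleton ∞).compl
  have h1 : ∀ᵐ t ∂(P.map (count X A)), t ≠ ∞ := by
    rw [h.poisson_count A hA hAf, ae_map_iff (Measurable.aemeasurable (by fun_prop)) hS]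
    exact Filter.Eventually.of_forall fun n => ENNReal.natCast_ne_top n
  exact (ae_map_iff hm.aemeasurable hS).1 h1

lemma IsMarkedPPP.ae_exists_closest (h : IsMarkedPPP P lam ν X g) :
    ∀ᵐ ω ∂P, ∃ i, ∀ j, ‖X i ω‖ ≤ ‖X j ω‖ := by
  have h1 : ∀ᵐ ω ∂P, ∀ n : ℕ, count X (Metric.closedBall 0 n) ω ≠ ∞ :=
    ae_all_iff.2 fun n => h.ae_count_ne_top Metric.isClosed_closedBall.measurableSet
      measure_closedBall_lt_top.ne
  filter_upwards [h1] with ω hω using exists_forall_norm_le hω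

lemma IsMarkedPPP.ae_ne_zero [IsProbabilityMeasure P] (h : IsMarkedPPP P lam ν X g) :
    ∀ᵐ ω ∂P, ∀ i, X i ω ≠ 0 := by
  have hX := h.measurable_loc
  have h0 : MeasurableSet ({0} : Set Plane) := measurableSet_singleton 0
  have h1 := h.campbell_formula (w := ({0} : Set Plane).indicator 1) (measurable_one.indicator h0)
  have hm : ∀ i, Measurable fun ω => ({0} : Set Plane).indicator (1 : Plane → ℝ≥0∞) (X i ω) :=
    fun i => (measurable_one.indicator h0).comp (hX i)
  rw [lintegral_indicator_one h0, measure_singleton, mul_zero, lintegral_eq_zero_iff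
    (Measurable.tsum hm)] at h1
  filter_upwards [h1] with ω hω i hi
  have := ENNReal.tsum_eq_zero.1 hω i
  simp [hi] at this

lemma ofReal_mul_lintegral_exp {lam c : ℝ} (hlam : 0 < lam) (hc : 0 < c) :
    ENNReal.ofReal lam * ∫⁻ x : Plane, ENNReal.ofReal (Real.exp (-(Real.pi * lam * c * ‖x‖ ^ 2))) =
      ENNReal.ofReal (1 / c) := by
  have hp := Real.pi_pos
  rw [lintegral_exp_neg_mul_sq_norm (by positivity), ← ENNReal.ofReal_mul hlam.le]
  congr 1
  field_simp

lemma ae_norm_pos : ∀ᵐ x : Plane, 0 < ‖x‖ := by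
  have h0 : volume ({0} : Set Plane) = 0 := measure_singleton _
  filter_upwards [compl_mem_ae_iff.2 h0] with x hx
  exact norm_pos_iff.2 hx

open Classical in
/-- Almost surely there is exactly one closest base station. -/
lemma IsMarkedPPP.ae_tsum_closest [IsProbabilityMeasure P] (hlam : 0 < lam)
    (h : IsMarkedPPP P lam ν X g) :
    ∀ᵐ ω ∂P, ∑' i, (if ∀ j, ‖X i ω‖ ≤ ‖X j ω‖ then (1 : ℝ≥0∞) else 0) = 1 := by
  have hXm : Measurable fun ω k => X k ω := measurable_pi_lambda _ h.measurable_loc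
  -- With `κ = 0` only the void event remains, so `α = 3` and `m = 1` are arbitrary choices.
  have h1 := h.lintegral_tsum_eligible_mul_expNeg (α := 3) one_pos .closest (u := fun _ => 1)
    measurable_const (fun _ => le_rfl) (κ := fun _ => 0) continuous_const monotoneOn_const
  have h2 : ∀ᵐ x : Plane, expNeg (ENNReal.ofReal lam * Association.closest.exponent 3 1 0 ‖x‖) =
      ENNReal.ofReal (Real.exp (-(Real.pi * lam * 1 * ‖x‖ ^ 2))) := by
    filter_upwards [ae_norm_pos] with x hx
    rw [exponent_closest (by norm_num) one_pos le_rfl hx, eta_zero (by norm_num),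
      ← ENNReal.ofReal_mul hlam.le, expNeg_ofReal (by positivity)]
    congr 3
    ring
  simp only [zero_mul, ENNReal.ofReal_zero, gammaLogLaplace_zero, ite_self, tsum_zero, expNeg_zero,
    mul_one, one_mul] at h1
  rw [lintegral_congr_ae h2, ofReal_mul_lintegral_exp hlam one_pos] at h1
  simp only [div_one, ENNReal.ofReal_one] at h1
  have hm : Measurable fun ω => ∑' i, Association.closest.eligible i fun k => X k ω :=
    Measurable.tsum fun i => (Association.closest.measurable_eligible i).comp hXm
  have hge : ∀ᵐ ω ∂P, 1 ≤ ∑' i, Association.closest.eligible i fun k => X k ω := by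
    filter_upwards [h.ae_exists_closest] with ω ⟨i, hi⟩
    refine le_trans ?_ (ENNReal.le_tsum i)
    rw [Association.eligible_closest, if_pos hi]
  -- The number of closest stations is a.s. at least one and has mean one, so it is a.s. equal to
  -- one.
  have heq := ae_eq_of_ae_le_of_lintegral_le hge (by simp) hm.aemeasurable (by simp [h1])
  filter_upwards [heq] with ω hω
  simp_rw [Association.eligible_closest] at hω
  exact hω.symm

lemma closest_server_eq {Ω : Type*} {X : ℕ → Ω → Plane} {g : ℕ → Ω → ℝ} {l : ℝ → ℝ} {ω : Ω} {i : ℕ}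
    (hi : {i | ∀ j, ‖X i ω‖ ≤ ‖X j ω‖} = {i}) : Association.closest.server l X g ω = i := by
  rw [Association.server, hi, csInf_singleton]

/-- Functionals of the closest base station as sums over all base stations. -/
lemma IsMarkedPPP.ae_closest_eq_tsum [IsProbabilityMeasure P] (hlam : 0 < lam)
    (h : IsMarkedPPP P lam ν X g) (l : ℝ → ℝ) :
    ∀ᵐ ω ∂P, ∀ F : ℕ → ℝ≥0∞, F (Association.closest.server l X g ω) =
      ∑' i, Association.closest.eligible i (fun k => X k ω) * F i := by
  classical
  filter_upwards [h.ae_tsum_closest hlam, h.ae_exists_closest] with ω hω ⟨i, hi⟩ F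
  have huniq : ∀ k, (∀ j, ‖X k ω‖ ≤ ‖X j ω‖) → k = i := fun k hk => by
    by_contra hki
    have h2 : ∑ j ∈ {k, i}, (if ∀ j', ‖X j ω‖ ≤ ‖X j' ω‖ then (1 : ℝ≥0∞) else 0) ≤ 1 :=
      (ENNReal.sum_le_tsum _).trans hω.le
    rw [Finset.sum_pair hki, if_pos hk, if_pos hi] at h2
    norm_num at h2
  have hset : {i | ∀ j, ‖X i ω‖ ≤ ‖X j ω‖} = {i} := by
    ext k
    exact ⟨huniq k, fun hk => by rw [mem_singleton_iff.1 hk]; exact hi⟩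
  rw [closest_server_eq hset, tsum_eq_single i fun k hk => ?_]
  · rw [Association.eligible_closest, if_pos hi, one_mul]
  · rw [Association.eligible_closest, if_neg fun hk' => hk (huniq k hk'), zero_mul]

lemma IsMarkedPPP.measurable_closest_server (h : IsMarkedPPP P lam ν X g) (l : ℝ → ℝ) :
    Measurable (Association.closest.server l X g) := by
  classical
  have hS : ∀ i, MeasurableSet {ω | ∀ j, ‖X i ω‖ ≤ ‖X j ω‖} := fun i => by
    simp only [ofPred_forall]
    exact MeasurableSet.iInter fun j =>
      measurableSet_le (h.measurable_loc i).norm (h.measurable_loc j).norm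
  refine measurable_of_Iic fun n => ?_
  -- The last piece covers the case of no minimiser, where `sInf ∅ = 0` lies in every `Iic n`.
  have : Association.closest.server l X g ⁻¹' Iic n =
      (⋃ i ∈ Iic n, {ω | ∀ j, ‖X i ω‖ ≤ ‖X j ω‖}) ∪ ⋂ i, {ω | ∀ j, ‖X i ω‖ ≤ ‖X j ω‖}ᶜ := by
    ext ω
    simp only [mem_preimage, mem_Iic, mem_union, mem_iUnion, mem_iInter, mem_compl_iff,
      mem_ofPred_eq, exists_prop]
    by_cases hne : {i | ∀ j, ‖X i ω‖ ≤ ‖X j ω‖}.Nonempty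
    · constructor
      · exact fun hn => Or.inl ⟨_, hn, Nat.sInf_mem hne⟩
      · rintro (⟨i, hi, hi'⟩ | hn)
        · exact (Nat.sInf_le (show i ∈ {i | ∀ j, ‖X i ω‖ ≤ ‖X j ω‖} from hi')).trans hi
        · obtain ⟨i, hi⟩ := hne
          exact absurd hi (hn i)
    · have he := not_nonempty_iff_eq_empty.1 hne
      constructor
      · refine fun _ => Or.inr fun i hi => hne ⟨i, hi⟩
      · intro _
        change sInf {i | ∀ j, ‖X i ω‖ ≤ ‖X j ω‖} ≤ n
        rw [he, Nat.sInf_empty]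
        exact Nat.zero_le n
  rw [this]
  exact (MeasurableSet.biUnion (to_countable _) fun i _ => hS i).union
    (MeasurableSet.iInter fun i => (hS i).compl)

lemma measurable_apply_index {Ω E : Type*} [MeasurableSpace Ω] [MeasurableSpace E] {k : Ω → ℕ}
    (hk : Measurable k) {F : ℕ → Ω → E} (hF : ∀ i, Measurable (F i)) :
    Measurable fun ω => F (k ω) ω :=
  (measurable_from_prod_countable_right (f := fun p : ℕ × Ω => F p.1 p.2) hF).comp
    (hk.prodMk measurable_id)

lemma IsMarkedPPP.measurable_closestDist (h : IsMarkedPPP P lam ν X g) (l : ℝ → ℝ) :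
    Measurable (closestDist l X g) :=
  measurable_apply_index (h.measurable_closest_server l) fun i => (h.measurable_loc i).norm

/-- The conditional Laplace transform of the interference given the distance of the closest base
station. -/
theorem IsMarkedPPP.closestCondLaplace [IsProbabilityMeasure P] (hα : 2 < α) (hlam : 0 < lam)
    (hm : 0 < m) (h : IsMarkedPPP P lam (gammaMeasure m m) X g) {s : ℝ} (hs : 0 ≤ s) :
    ClosestCondLaplace P (pathloss α 0) X g s
      (fun r => Real.exp (-(Real.pi * lam * r ^ 2 * (eta α s m r - 1)))) := by
  set l := pathloss α 0
  set D := closestDist l X g with hDdef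
  set S := Association.closest.server l X g with hSdef
  have hψ := measurable_gammaLogLaplace m
  have hD : Measurable D := h.measurable_closestDist l
  have hI : Measurable fun ω => interference l X g (S ω) ω :=
    measurable_apply_index (h.measurable_closest_server l) h.measurable_interference
  -- Writing the exponent as a parametric integral makes the candidate `V` measurable in `r` without
  -- studying `eta` in that variable.
  let J : ℝ → ℝ≥0∞ := fun r => ∫⁻ y : Plane, (if r < ‖y‖ then
    1 - expNeg (gammaLogLaplace m (ENNReal.ofReal (s * ‖y‖ ^ (-α)))) else 0)
  have hJ : Measurable J := by
    refine Measurable.lintegral_prod_right' (f := fun p : ℝ × Plane => if p.1 < ‖p.2‖ then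
      1 - expNeg (gammaLogLaplace m (ENNReal.ofReal (s * ‖p.2‖ ^ (-α)))) else 0) ?_
    exact Measurable.ite (measurableSet_lt measurable_fst measurable_snd.norm) (by fun_prop)
      measurable_const
  let V : ℝ → ℝ≥0∞ := fun r => expNeg (ENNReal.ofReal lam * J r)
  have hV : Measurable V := (hJ.const_mul _).expNeg
  have hVr : ∀ r, 0 < r →
      V r = ENNReal.ofReal (Real.exp (-(Real.pi * lam * r ^ 2 * (eta α s m r - 1)))) := fun r hr => by
    have hη := one_le_eta (s := s) (r := r) hα hm (by positivity)
    simp only [V, J]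
    rw [lintegral_one_sub_expNeg_gammaLogLaplace_beyond hα hm hs hr, ← ENNReal.ofReal_mul hlam.le,
      expNeg_ofReal (mul_nonneg hlam.le (mul_nonneg (by positivity) (by linarith)))]
    congr 3
    ring
  have hLV : (fun ω => Real.exp (-(Real.pi * lam * D ω ^ 2 * (eta α s m (D ω) - 1)))) =ᵐ[P]
      fun ω => (V (D ω)).toReal := by
    filter_upwards [h.ae_ne_zero] with ω hω
    have hDω : 0 < D ω := norm_pos_iff.2 (hω _)
    rw [hVr _ hDω, ENNReal.toReal_ofReal (Real.exp_nonneg _)]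
  have hVle : ∀ r, (V r).toReal ≤ 1 := fun r =>
    ENNReal.toReal_le_of_le_ofReal zero_le_one (by simpa using expNeg_le_one _)
  have hVint : Integrable (fun ω => (V (D ω)).toReal) P :=
    Integrable.of_bound (hV.comp hD).ennreal_toReal.aestronglyMeasurable 1
      (Filter.Eventually.of_forall fun ω => by
        rw [Real.norm_of_nonneg ENNReal.toReal_nonneg]; exact hVle _)
  have hYint : Integrable (fun ω => Real.exp (-(s * (interference l X g (S ω) ω).toReal))) P :=
    Integrable.of_bound (Measurable.aestronglyMeasurable (by fun_prop)) 1
      (Filter.Eventually.of_forall fun ω => by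
        rw [Real.norm_of_nonneg (Real.exp_nonneg _), Real.exp_le_one_iff]
        exact neg_nonpos.2 (by positivity))
  have hT := h.ae_tsum_rxPower_ne_top hα hlam hm
  have key : ∀ C : Set ℝ, MeasurableSet C →
      ∫⁻ ω in D ⁻¹' C, V (D ω) ∂P = ∫⁻ ω in D ⁻¹' C,
        ENNReal.ofReal (Real.exp (-(s * (interference l X g (S ω) ω).toReal))) ∂P := by
    intro C hC
    have hCn : Measurable fun x : Plane => C.indicator (1 : ℝ → ℝ≥0∞) ‖x‖ :=
      (measurable_one.indicator hC).comp measurable_norm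
    have hC1 : ∀ r, C.indicator (1 : ℝ → ℝ≥0∞) r ≤ 1 := fun r =>
      indicator_le (fun _ _ => le_rfl) r
    have hsrv := h.ae_closest_eq_tsum hlam l
    have e1 := h.lintegral_tsum_eligible_mul_expNeg (α := α) hm .closest
      (u := fun x => C.indicator 1 ‖x‖ * V ‖x‖) (hCn.mul (hV.comp measurable_norm))
      (fun x => mul_le_one' (hC1 _) (expNeg_le_one _)) (κ := fun _ => 0) continuous_const
      monotoneOn_const
    have e2 := h.lintegral_tsum_eligible_mul_expNeg (α := α) hm .closest
      (u := fun x => C.indicator 1 ‖x‖) hCn (fun x => hC1 _) (κ := fun _ => s) continuous_const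
      monotoneOn_const
    -- The exponents add: `πλr²(η - 1)` from `V` and `πλr²` from the void probability give `πλr²η`,
    -- which already includes the void event.
    have e3 : ∀ᵐ x : Plane, C.indicator 1 ‖x‖ * V ‖x‖ * expNeg (ENNReal.ofReal lam *
        Association.closest.exponent α m 0 ‖x‖) = C.indicator 1 ‖x‖ * expNeg (ENNReal.ofReal lam *
        Association.closest.exponent α m s ‖x‖) := by
      filter_upwards [ae_norm_pos] with x hx
      have hη := one_le_eta (s := s) (r := ‖x‖) hα hm (by positivity)
      rw [exponent_closest hα hm le_rfl hx, exponent_closest hα hm hs hx, eta_zero hα, hVr _ hx,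
        ← ENNReal.ofReal_mul hlam.le, ← ENNReal.ofReal_mul hlam.le, expNeg_ofReal (by positivity),
        expNeg_ofReal (mul_nonneg hlam.le (mul_nonneg (by positivity) (by linarith))), mul_assoc,
        ← ENNReal.ofReal_mul (Real.exp_nonneg _), ← Real.exp_add]
      congr 4
      ring
    rw [lintegral_congr_ae e3, ← e2] at e1
    rw [← lintegral_indicator (hD hC), ← lintegral_indicator (hD hC)]
    have e4 : ∫⁻ ω, (D ⁻¹' C).indicator (fun ω => V (D ω)) ω ∂P = _ := Eq.trans ?_ e1
    · rw [e4]
      have e5 := h.lintegral_tsum_mul_expNeg_marks (isLogLaplace_gamma hm) (gammaLogLaplace_zero m)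
        (w := fun i x => C.indicator 1 ‖x i‖ * Association.closest.eligible i x)
        (c := fun x y => ENNReal.ofReal (s * ‖y‖ ^ (-α)))
        (fun i => (hCn.comp (measurable_pi_apply i)).mul
          (Association.closest.measurable_eligible i)) (by fun_prop) fun _ _ => ENNReal.ofReal_ne_top
      rw [← e5]
      refine lintegral_congr_ae ?_
      filter_upwards [hsrv, hT] with ω hω hTω
      have hI : ∀ i, interference l X g i ω ≠ ∞ := fun i =>
        ne_top_of_le_ne_top hTω (interference_le_tsum l i ω)
      have e6 : (D ⁻¹' C).indicator (fun ω => ENNReal.ofReal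
          (Real.exp (-(s * (interference l X g (S ω) ω).toReal)))) ω =
          C.indicator 1 ‖X (S ω) ω‖ * expNeg (ENNReal.ofReal s * interference l X g (S ω) ω) := by
        rw [← ofReal_exp_neg_mul_toReal hs (hI _)]
        by_cases hc : ‖X (S ω) ω‖ ∈ C
        · rw [indicator_of_mem (show ω ∈ D ⁻¹' C from hc), indicator_of_mem hc, Pi.one_apply, one_mul]
        · rw [indicator_of_notMem (show ω ∉ D ⁻¹' C from hc), indicator_of_notMem hc, zero_mul]
      rw [e6, hω fun i => C.indicator 1 ‖X i ω‖ *
        expNeg (ENNReal.ofReal s * interference l X g i ω)]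
      refine tsum_congr fun i => ?_
      rw [mul_left_comm, ← mul_assoc]
      congr 2
      rw [interference, ← ENNReal.tsum_mul_left]
      refine tsum_congr fun j => ?_
      split_ifs
      · simp
      · rw [rxPower_pathloss, ENNReal.ofReal_mul hs]
        ring
    · refine lintegral_congr_ae ?_
      filter_upwards [hsrv] with ω hω
      have e6 : (D ⁻¹' C).indicator (fun ω => V (D ω)) ω =
          C.indicator 1 ‖X (S ω) ω‖ * V ‖X (S ω) ω‖ := by
        by_cases hc : ‖X (S ω) ω‖ ∈ C
        · rw [indicator_of_mem (show ω ∈ D ⁻¹' C from hc), indicator_of_mem hc, Pi.one_apply, one_mul]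
          rfl
        · rw [indicator_of_notMem (show ω ∉ D ⁻¹' C from hc), indicator_of_notMem hc, zero_mul]
      rw [e6, hω fun i => C.indicator 1 ‖X i ω‖ * V ‖X i ω‖]
      refine tsum_congr fun i => ?_
      simp [gammaLogLaplace_zero, expNeg_zero, mul_comm]
  -- Every set of the generated σ-algebra has the form `D ⁻¹' C`, so `key` characterises the
  -- conditional expectation.
  have hcond := ae_eq_condExp_of_forall_setIntegral_eq (μ := P)
    (m := MeasurableSpace.comap D inferInstance) hD.comap_le hYint
    (g := fun ω => (V (D ω)).toReal) (fun _ _ _ => hVint.integrableOn) ?_ ?_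
  · exact hcond.symm.trans hLV.symm
  · rintro _ ⟨C, hC, rfl⟩ -
    rw [integral_toReal (f := fun ω => V (D ω)) (hV.comp hD).aemeasurable (Filter.Eventually.of_forall fun ω =>
      (expNeg_ne_top _).lt_top), key C hC, integral_eq_lintegral_of_nonneg_ae
      (Filter.Eventually.of_forall fun _ => Real.exp_nonneg _)
      hYint.aestronglyMeasurable.restrict]
  · exact (hV.ennreal_toReal.comp (comap_measurable D)).aestronglyMeasurable

end PPP

section PPP

variable {Ω : Type*} [MeasurableSpace Ω] {P : Measure Ω} {lam α m : ℝ} {ν : Measure ℝ}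
    {X : ℕ → Ω → Plane} {g : ℕ → Ω → ℝ}

/-! ### The interference seen from a generic base station -/

/-- The weight is the indicator of `B` and the exponent does not depend on the chosen point, so the
reduced Campbell formula factorises into `λ|B|` times the Laplace functional. -/
theorem IsMarkedPPP.palmLaplace [IsProbabilityMeasure P] (hα : 2 < α) (hlam : 0 < lam)
    (hm : 0 < m) (h : IsMarkedPPP P lam (gammaMeasure m m) X g) {s : ℝ} (hs : 0 ≤ s) :
    PalmLaplace P lam (pathloss α 0) X g s
      (Real.exp (-(2 * Real.pi * lam * zetaFun α m * (s / m) ^ (2 / α)))) := by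
  intro B hB
  have hψ := measurable_gammaLogLaplace m
  have hζ := zetaFun_pos hα hm
  have hBm : Measurable (B.indicator (1 : Plane → ℝ≥0∞)) := measurable_one.indicator hB
  have e1 := h.lintegral_tsum_mul_expNeg_marks (isLogLaplace_gamma hm) (gammaLogLaplace_zero m)
    (w := fun i x => B.indicator 1 (x i)) (c := fun x y => ENNReal.ofReal (s * ‖y‖ ^ (-α)))
    (fun i => hBm.comp (measurable_pi_apply i)) (by fun_prop) fun _ _ => ENNReal.ofReal_ne_top
  have e2 := h.lintegral_tsum_mul_expNeg_others (w := B.indicator 1)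
    (f := fun y => gammaLogLaplace m (ENNReal.ofReal (s * ‖y‖ ^ (-α)))) (by fun_prop) hBm
    fun _ _ => gammaLogLaplace_ne_top _ _
  rw [e2, lintegral_indicator_one hB, lintegral_one_sub_expNeg_gammaLogLaplace hα hm hs,
    ← ENNReal.ofReal_mul hlam.le, expNeg_ofReal (by positivity)] at e1
  rw [mul_comm (Real.exp _), ENNReal.ofReal_mul hlam.le, mul_right_comm]
  have e3 : lam * (Real.pi * (2 * zetaFun α m) * (s / m) ^ (2 / α)) =
    2 * Real.pi * lam * zetaFun α m * (s / m) ^ (2 / α) := by ring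
  rw [← e3, ← e1]
  refine lintegral_congr_ae ?_
  filter_upwards [h.ae_tsum_rxPower_ne_top hα hlam hm] with ω hω
  refine tsum_congr fun i => ?_
  by_cases hi : X i ω ∈ B
  · rw [indicator_of_mem hi, indicator_of_mem hi, Pi.one_apply, one_mul,
      ofReal_exp_neg_mul_toReal hs (ne_top_of_le_ne_top hω (interference_le_tsum _ i ω)),
      interference, ← ENNReal.tsum_mul_left]
    congr 1
    refine tsum_congr fun j => ?_
    split_ifs
    · simp
    · rw [rxPower_pathloss, ENNReal.ofReal_mul hs]
      ring
  · rw [indicator_of_notMem hi, indicator_of_notMem hi, zero_mul]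

/-! ### Coverage probabilities -/

/-- Scale invariance: the exponent at `s = θ r^α` becomes a constant times `r²`, leaving a Gaussian
integral. -/
lemma eta_mul_rpow {α θ r : ℝ} (hr : 0 < r) : eta α (θ * r ^ α) 1 r = eta α θ 1 1 := by
  rw [eta, eta, one_mul, one_mul, Real.one_rpow, div_one,
    mul_div_cancel_right₀ _ (Real.rpow_pos_of_pos hr _).ne']

lemma mul_rpow_two_div {α θ r : ℝ} (hα : 0 < α) (hθ : 0 ≤ θ) (hr : 0 ≤ r) :
    (θ * r ^ α) ^ (2 / α) = θ ^ (2 / α) * r ^ 2 := by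
  rw [Real.mul_rpow hθ (by positivity), ← Real.rpow_mul hr, mul_div_cancel₀ _ hα.ne',
    Real.rpow_two]

lemma IsMarkedPPP.measurable_SIR (h : IsMarkedPPP P lam ν X g) (i : ℕ) :
    Measurable (SIR (pathloss α 0) X g i) :=
  (h.measurable_rxPower i).div (h.measurable_interference i)

/-- Because the threshold is positive and finite, this holds even when the interference is `0` or
`∞`. -/
lemma lt_SIR_iff {Ω : Type*} {l : ℝ → ℝ} {X : ℕ → Ω → Plane} {g : ℕ → Ω → ℝ} {θ : ℝ} (hθ : 0 < θ)
    (i : ℕ) (ω : Ω) : ENNReal.ofReal θ < SIR l X g i ω ↔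
      ENNReal.ofReal θ * interference l X g i ω < rxPower l X g i ω :=
  ENNReal.lt_div_iff_mul_lt (Or.inr ENNReal.ofReal_ne_top)
    (Or.inr (ENNReal.ofReal_pos.2 hθ).ne')

/-- Dividing by the server's path loss isolates its mark, the form required for averaging over
exponential marks. -/
lemma lt_SIR_pathloss_iff {Ω : Type*} {X : ℕ → Ω → Plane} {g : ℕ → Ω → ℝ} {θ : ℝ} (hθ : 0 < θ)
    {i : ℕ} {ω : Ω} (hX : X i ω ≠ 0) : ENNReal.ofReal θ < SIR (pathloss α 0) X g i ω ↔
      (∑' j, if j = i then 0 else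
        ENNReal.ofReal (g j ω) * ENNReal.ofReal (θ * ‖X i ω‖ ^ α * ‖X j ω‖ ^ (-α))) <
        ENNReal.ofReal (g i ω) := by
  have hA : 0 < ‖X i ω‖ ^ (-α) := Real.rpow_pos_of_pos (norm_pos_iff.2 hX) _
  rw [lt_SIR_iff hθ, rxPower_pathloss, ← ENNReal.div_lt_iff
    (Or.inl (ENNReal.ofReal_pos.2 hA).ne') (Or.inl ENNReal.ofReal_ne_top), div_eq_mul_inv,
    ← ENNReal.ofReal_inv_of_pos hA, interference, ← ENNReal.tsum_mul_left, ← ENNReal.tsum_mul_right]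
  refine iff_of_eq (congrArg (· < _) (tsum_congr fun j => ?_))
  split_ifs
  · simp
  · rw [rxPower_pathloss, ENNReal.ofReal_mul (by positivity), ENNReal.ofReal_mul hθ.le,
      Real.rpow_neg (norm_nonneg (X i ω)), inv_inv]
    ring

open Classical in
/-- The mean number of eligible servers which cover the user. -/
lemma IsMarkedPPP.lintegral_tsum_eligible_mul_covered [IsProbabilityMeasure P] (hα : 2 < α)
    (h : IsMarkedPPP P lam (expMeasure 1) X g) (a : Association) {θ : ℝ} (hθ : 0 < θ) :
    ∫⁻ ω, ∑' i, a.eligible i (fun k => X k ω) *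
        (if ENNReal.ofReal θ < SIR (pathloss α 0) X g i ω then 1 else 0) ∂P =
      ENNReal.ofReal lam *
        ∫⁻ x : Plane, expNeg (ENNReal.ofReal lam * a.exponent α 1 (θ * ‖x‖ ^ α) ‖x‖) := by
  have hα0 : 0 < α := by linarith
  have hκ : Continuous fun r : ℝ => θ * r ^ α :=
    (Real.continuous_rpow_const hα0.le).const_mul θ
  have e1 := h.lintegral_tsum_eligible_mul_expNeg (α := α) one_pos a (u := fun _ => 1)
    measurable_const (fun _ => le_rfl) hκ fun r hr r' _ hrr =>
      mul_le_mul_of_nonneg_left (Real.rpow_le_rpow hr hrr hα0.le) hθ.le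
  have e2 := h.lintegral_tsum_mul_indicator_marks (isLogLaplace_gamma one_pos)
    (gammaLogLaplace_zero 1) (w := a.eligible)
    (c := fun x y => ENNReal.ofReal (θ * ‖x‖ ^ α * ‖y‖ ^ (-α))) a.measurable_eligible (by fun_prop)
    fun _ _ => ENNReal.ofReal_ne_top
  simp only [one_mul] at e1
  rw [← e1, ← e2]
  refine lintegral_congr_ae ?_
  filter_upwards [h.ae_ne_zero] with ω hω
  refine tsum_congr fun i => ?_
  simp only [lt_SIR_pathloss_iff hθ (hω i)]

open Classical in
lemma Association.coverage_eq_toReal_lintegral (a : Association) {l : ℝ → ℝ} {θ : ℝ}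
    (hS : MeasurableSet {ω | ENNReal.ofReal θ < SIR l X g (a.server l X g ω) ω}) :
    a.coverage P l X g θ =
      (∫⁻ ω, if ENNReal.ofReal θ < SIR l X g (a.server l X g ω) ω then 1 else 0 ∂P).toReal := by
  rw [Association.coverage, measureReal_def, ← lintegral_indicator_one hS]
  simp only [indicator_apply, mem_ofPred_eq, Pi.one_apply]

theorem IsMarkedPPP.coverage_closest [IsProbabilityMeasure P] (hα : 2 < α) (hlam : 0 < lam)
    (h : IsMarkedPPP P lam (expMeasure 1) X g) {θ : ℝ} (hθ : 0 < θ) :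
    Association.closest.coverage P (pathloss α 0) X g θ = 1 / eta α θ 1 1 := by
  classical
  have hη : 1 ≤ eta α θ 1 1 := one_le_eta hα one_pos (by positivity)
  rw [Association.coverage_eq_toReal_lintegral _ (measurableSet_lt measurable_const
    (measurable_apply_index (h.measurable_closest_server _) h.measurable_SIR))]
  have e1 : ∫⁻ ω, (if ENNReal.ofReal θ < SIR (pathloss α 0) X g
      (Association.closest.server (pathloss α 0) X g ω) ω then 1 else 0) ∂P = _ :=
    (lintegral_congr_ae ?_).trans
      (h.lintegral_tsum_eligible_mul_covered hα .closest hθ)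
  · have e2 : ∀ᵐ x : Plane, expNeg (ENNReal.ofReal lam *
        Association.closest.exponent α 1 (θ * ‖x‖ ^ α) ‖x‖) =
        ENNReal.ofReal (Real.exp (-(Real.pi * lam * eta α θ 1 1 * ‖x‖ ^ 2))) := by
      filter_upwards [ae_norm_pos] with x hx
      rw [exponent_closest hα one_pos (by positivity) hx, eta_mul_rpow hx, ← ENNReal.ofReal_mul hlam.le,
        expNeg_ofReal (by positivity)]
      congr 3
      ring
    rw [e1, lintegral_congr_ae e2, ofReal_mul_lintegral_exp hlam (by linarith),
      ENNReal.toReal_ofReal (by positivity)]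
  · filter_upwards [h.ae_closest_eq_tsum hlam (pathloss α 0)] with ω hω using hω fun i =>
      if ENNReal.ofReal θ < SIR (pathloss α 0) X g i ω then 1 else 0

/-! ### Strongest association: uniqueness of a covering station -/

lemma rxPower_le_interference {Ω : Type*} {l : ℝ → ℝ} {X : ℕ → Ω → Plane} {g : ℕ → Ω → ℝ}
    {i j : ℕ} (hij : j ≠ i) (ω : Ω) : rxPower l X g j ω ≤ interference l X g i ω := by
  rw [interference]
  refine le_trans ?_ (ENNReal.le_tsum j)
  rw [if_neg hij]

/-- At most one base station has SIR larger than one. -/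
lemma SIR_le_one {Ω : Type*} {l : ℝ → ℝ} {X : ℕ → Ω → Plane} {g : ℕ → Ω → ℝ} {i j : ℕ} {ω : Ω}
    (hi : 1 < SIR l X g i ω) (hij : j ≠ i) : SIR l X g j ω ≤ 1 := by
  rw [← ENNReal.ofReal_one, lt_SIR_iff one_pos, ENNReal.ofReal_one, one_mul] at hi
  -- Each power is part of the other's interference: the power of `j` is at most the interference
  -- for `i`, hence below the power of `i`, hence at most the interference for `j`.
  exact ENNReal.div_le_of_le_mul (by
    rw [one_mul]
    exact (rxPower_le_interference hij ω).trans
      (hi.le.trans (rxPower_le_interference hij.symm ω)))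

lemma strongest_server_eq {Ω : Type*} {l : ℝ → ℝ} {X : ℕ → Ω → Plane} {g : ℕ → Ω → ℝ} {i : ℕ}
    {ω : Ω} (hi : 1 < SIR l X g i ω) : Association.strongest.server l X g ω = i := by
  have : {i | ∀ j, SIR l X g j ω ≤ SIR l X g i ω} = {i} := by
    ext k
    constructor
    · intro hk
      by_contra hki
      exact absurd (hi.trans_le (hk i)) (SIR_le_one hi hki).not_gt
    · rintro rfl j
      rcases eq_or_ne j k with rfl | hjk
      · exact le_rfl
      · exact (SIR_le_one hi hjk).trans hi.le
  rw [Association.server, this, csInf_singleton]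

lemma lt_SIR_strongest_server_iff {Ω : Type*} {l : ℝ → ℝ} {X : ℕ → Ω → Plane} {g : ℕ → Ω → ℝ}
    {t : ℝ≥0∞} (ht : 1 ≤ t) (ω : Ω) :
    t < SIR l X g (Association.strongest.server l X g ω) ω ↔ ∃ i, t < SIR l X g i ω := by
  refine ⟨fun h => ⟨_, h⟩, ?_⟩
  rintro ⟨i, hi⟩
  rwa [strongest_server_eq (ht.trans_lt hi)]

-- For thresholds at least one the sum has at most one nonzero term. This replaces the maximum over
-- stations by a sum, to which the Campbell formula applies.
open Classical in
lemma ite_lt_SIR_strongest_server {Ω : Type*} {l : ℝ → ℝ} {X : ℕ → Ω → Plane} {g : ℕ → Ω → ℝ}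
    {t : ℝ≥0∞} (ht : 1 ≤ t) (ω : Ω) :
    (if t < SIR l X g (Association.strongest.server l X g ω) ω then (1 : ℝ≥0∞) else 0) =
      ∑' i, if t < SIR l X g i ω then 1 else 0 := by
  by_cases hω : ∃ i, t < SIR l X g i ω
  · rw [if_pos ((lt_SIR_strongest_server_iff ht ω).2 hω)]
    obtain ⟨i, hi⟩ := hω
    rw [tsum_eq_single i fun j hj => if_neg ((SIR_le_one (ht.trans_lt hi) hj).trans ht).not_gt,
      if_pos hi]
  · rw [if_neg (mt (lt_SIR_strongest_server_iff ht ω).1 hω)]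
    push Not at hω
    simp [(hω _).not_gt]

theorem IsMarkedPPP.coverage_strongest [IsProbabilityMeasure P] (hα : 2 < α) (hlam : 0 < lam)
    (h : IsMarkedPPP P lam (expMeasure 1) X g) {θ : ℝ} (hθ : 1 ≤ θ) :
    Association.strongest.coverage P (pathloss α 0) X g θ =
      1 / (2 * zetaFun α 1 * θ ^ (2 / α)) := by
  classical
  have hθ0 : 0 < θ := by linarith
  have hα0 : 0 < α := by linarith
  have hζ := zetaFun_pos hα one_pos
  have ht : 1 ≤ ENNReal.ofReal θ := ENNReal.one_le_ofReal.2 hθ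
  have hθα : 0 < θ ^ (2 / α) := Real.rpow_pos_of_pos hθ0 _
  rw [Association.coverage_eq_toReal_lintegral]
  · have e1 := h.lintegral_tsum_eligible_mul_covered hα .strongest hθ0
    simp only [Association.eligible_strongest, one_mul] at e1
    have e2 : ∀ x : Plane, expNeg (ENNReal.ofReal lam *
        Association.strongest.exponent α 1 (θ * ‖x‖ ^ α) ‖x‖) =
        ENNReal.ofReal (Real.exp (-(Real.pi * lam * (2 * zetaFun α 1 * θ ^ (2 / α)) *
          ‖x‖ ^ 2))) := fun x => by
      rw [exponent_strongest hα one_pos (by positivity), div_one,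
        mul_rpow_two_div hα0 hθ0.le (norm_nonneg x), ← ENNReal.ofReal_mul hlam.le, expNeg_ofReal (by positivity)]
      congr 3
      ring
    simp_rw [ite_lt_SIR_strongest_server ht]
    rw [e1]
    simp_rw [e2]
    rw [ofReal_mul_lintegral_exp hlam (by positivity), ENNReal.toReal_ofReal (by positivity)]
  · simp_rw [lt_SIR_strongest_server_iff ht, ofPred_exists]
    exact MeasurableSet.iUnion fun i => measurableSet_lt measurable_const (h.measurable_SIR i)

/-! ### The unified coverage expression -/

lemma div_pathloss_zero {θ r : ℝ} (hr : 0 < r) : θ / pathloss α 0 r = θ * r ^ α := by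
  rw [pathloss_zero hr.le, Real.rpow_neg hr.le, div_inv_eq_mul]

/-- The void factor in the density supplies the missing `πλr²`, so the integrand is `2πλ r e^{-πλ η
r²}`. -/
theorem IsMarkedPPP.coverageIntegral_closest [IsProbabilityMeasure P] (hα : 2 < α) (hlam : 0 < lam)
    (h : IsMarkedPPP P lam (expMeasure 1) X g) {θ : ℝ} (hθ : 0 < θ) :
    Association.closest.coverageIntegral P lam (pathloss α 0) X g θ = 1 / eta α θ 1 1 := by
  have hη : 1 ≤ eta α θ 1 1 := one_le_eta hα one_pos (by positivity)
  have hp := Real.pi_pos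
  have e1 : ∀ r ∈ Ioi (0 : ℝ), Association.closest.laplaceInterference P (pathloss α 0) X g r
      (θ / pathloss α 0 r) * Association.closest.density lam r = 2 * Real.pi * lam *
        (r * Real.exp (-(Real.pi * lam * eta α θ 1 1 * r ^ 2))) := fun r hr => by
    have hr : 0 < r := hr
    rw [div_pathloss_zero hr, IsMarkedPPP.laplaceInterference_closest hα hlam one_pos h
      (by positivity) hr, eta_mul_rpow hr, Association.density]
    have h2 : -(Real.pi * lam * eta α θ 1 1 * r ^ 2) =
      -(Real.pi * lam * r ^ 2 * (eta α θ 1 1 - 1)) + -(Real.pi * lam * r ^ 2) := by ring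
    rw [h2, Real.exp_add]
    ring
  rw [Association.coverageIntegral, setIntegral_congr_fun measurableSet_Ioi e1,
    integral_const_mul, integral_mul_exp_neg_mul_sq_Ioi (by positivity)]
  field_simp

theorem IsMarkedPPP.coverageIntegral_strongest [IsProbabilityMeasure P] (hα : 2 < α)
    (hlam : 0 < lam) (h : IsMarkedPPP P lam (expMeasure 1) X g) {θ : ℝ} (hθ : 0 < θ) :
    Association.strongest.coverageIntegral P lam (pathloss α 0) X g θ =
      1 / (2 * zetaFun α 1 * θ ^ (2 / α)) := by
  have hα0 : 0 < α := by linarith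
  have hζ := zetaFun_pos hα one_pos
  have hp := Real.pi_pos
  have hθα : 0 < θ ^ (2 / α) := Real.rpow_pos_of_pos hθ _
  have e1 : ∀ r ∈ Ioi (0 : ℝ), Association.strongest.laplaceInterference P (pathloss α 0) X g r
      (θ / pathloss α 0 r) * Association.strongest.density lam r = 2 * Real.pi * lam *
        (r * Real.exp (-(Real.pi * lam * (2 * zetaFun α 1 * θ ^ (2 / α)) * r ^ 2))) :=
      fun r hr => by
    have hr : 0 < r := hr
    rw [div_pathloss_zero hr, IsMarkedPPP.laplaceInterference_strongest hα hlam one_pos h r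
      (by positivity), div_one, mul_rpow_two_div hα0 hθ.le hr.le, Association.density]
    have h2 : -(2 * Real.pi * lam * zetaFun α 1 * (θ ^ (2 / α) * r ^ 2)) =
      -(Real.pi * lam * (2 * zetaFun α 1 * θ ^ (2 / α)) * r ^ 2) := by ring
    rw [h2]
    ring
  rw [Association.coverageIntegral, setIntegral_congr_fun measurableSet_Ioi e1,
    integral_const_mul, integral_mul_exp_neg_mul_sq_Ioi (by positivity)]
  field_simp

end PPP

end Downlink

/-! ### Assembly of the LOS and NLOS statements -/

theorem mainTheorem9 {Ω : Type*} [MeasurableSpace Ω] (P : Measure Ω) [IsProbabilityMeasure P]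
    (lam α : ℝ) (hlam : 0 < lam) (hα : 2 < α)
    (X : ℕ → Ω → Downlink.Plane) (g : ℕ → Ω → ℝ) :
    -- LOS: Nakagami-`m` fading, i.e. the power gains have law `Γ(m, 1/m)`
    (∀ m : ℝ, 0 < m → Downlink.IsMarkedPPP P lam (gammaMeasure m m) X g →
      (∀ᵐ ω ∂P, ∑' j, Downlink.rxPower (Downlink.pathloss α 0) X g j ω ≠ ∞) ∧
      ∀ s : ℝ, 0 ≤ s →
        (∀ r : ℝ, 0 < r →
          Downlink.Association.closest.laplaceInterference P (Downlink.pathloss α 0) X g r s =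
              Real.exp (-(Real.pi * lam * r ^ 2 * (Downlink.eta α s m r - 1))) ∧
          Downlink.Association.strongest.laplaceInterference P (Downlink.pathloss α 0) X g r s =
              Real.exp (-(2 * Real.pi * lam * Downlink.zetaFun α m * (s / m) ^ (2 / α)))) ∧
        Downlink.ClosestCondLaplace P (Downlink.pathloss α 0) X g s
          (fun r => Real.exp (-(Real.pi * lam * r ^ 2 * (Downlink.eta α s m r - 1)))) ∧
        Downlink.PalmLaplace P lam (Downlink.pathloss α 0) X g s
          (Real.exp (-(2 * Real.pi * lam * Downlink.zetaFun α m * (s / m) ^ (2 / α))))) ∧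
    -- NLOS: Rayleigh fading, i.e. the power gains are exponential with mean one
    (Downlink.IsMarkedPPP P lam (expMeasure 1) X g →
      (∀ᵐ ω ∂P, ∑' j, Downlink.rxPower (Downlink.pathloss α 0) X g j ω ≠ ∞) ∧
      (∀ s : ℝ, 0 ≤ s →
        (∀ r : ℝ, 0 < r →
          Downlink.Association.closest.laplaceInterference P (Downlink.pathloss α 0) X g r s =
              Real.exp (-(Real.pi * lam * r ^ 2 * (Downlink.eta α s 1 r - 1))) ∧
          Downlink.Association.strongest.laplaceInterference P (Downlink.pathloss α 0) X g r s =
              Real.exp (-(2 * Real.pi * lam * Downlink.zetaFun α 1 * s ^ (2 / α)))) ∧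
        Downlink.ClosestCondLaplace P (Downlink.pathloss α 0) X g s
          (fun r => Real.exp (-(Real.pi * lam * r ^ 2 * (Downlink.eta α s 1 r - 1)))) ∧
        Downlink.PalmLaplace P lam (Downlink.pathloss α 0) X g s
          (Real.exp (-(2 * Real.pi * lam * Downlink.zetaFun α 1 * s ^ (2 / α))))) ∧
      (∀ θ : ℝ, 0 < θ →
        Downlink.Association.closest.coverage P (Downlink.pathloss α 0) X g θ =
            1 / Downlink.eta α θ 1 1 ∧
        Downlink.Association.closest.coverageIntegral P lam (Downlink.pathloss α 0) X g θ =
            1 / Downlink.eta α θ 1 1 ∧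
        (1 ≤ θ → Downlink.Association.strongest.coverage P (Downlink.pathloss α 0) X g θ =
            1 / (2 * Downlink.zetaFun α 1 * θ ^ (2 / α))) ∧
        Downlink.Association.strongest.coverageIntegral P lam (Downlink.pathloss α 0) X g θ =
            1 / (2 * Downlink.zetaFun α 1 * θ ^ (2 / α)))) := by
  have los : ∀ m : ℝ, 0 < m → Downlink.IsMarkedPPP P lam (gammaMeasure m m) X g → _ :=
    fun m hm h => And.intro (h.ae_tsum_rxPower_ne_top hα hlam hm) fun s (hs : 0 ≤ s) =>
      And.intro (fun r (hr : 0 < r) => And.intro (h.laplaceInterference_closest hα hlam hm hs hr)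
        (h.laplaceInterference_strongest hα hlam hm r hs))
      (And.intro (h.closestCondLaplace hα hlam hm hs) (h.palmLaplace hα hlam hm hs))
  refine ⟨los, fun h => ?_⟩
  -- `expMeasure 1` is by definition `gammaMeasure 1 1`, so Rayleigh fading is the case `m = 1`.
  obtain ⟨h1, h2⟩ := los 1 one_pos h
  simp only [div_one] at h2
  exact ⟨h1, h2, fun θ hθ => ⟨h.coverage_closest hα hlam hθ, h.coverageIntegral_closest hα hlam hθ,
    h.coverage_strongest hα hlam, h.coverageIntegral_strongest hα hlam hθ⟩⟩
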